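/- Let $G$ be a simply connected Lie group of dimension $n\ge 3$ whose Lie algebra $\mathfrak g$ contains an abelian ideal $\mathfrak h$ of codimension $1$ (that is, $G$ is almost abelian). Let $c$ be a conformal class of Riemannian metrics on $G$ containing a left-invariant metric $g$. A Weyl structure on $(G,c)$ is a torsion-free linear connection $\nabla$ preserving $c$, i.e. such that for every metric $g'\in c$ one has $\nabla g'=-2\theta_{g'}\otimes g'$ for some $1$-form $\theta_{g'}$, called the Lee form of $\nabla$ with respect to $g'$. It is called left-invariant if its Lee form with respect to every left-invariant metric in $c$ is left-invariant, and Weyl-Einstein if the trace-free part of the symmetrised Ricci tensor of $\nabla$ vanishes, i.e. if for some (equivalently, every) $g'\in c$ one has $$\tfrac12\bigl(\mathrm{Ric}^\nabla(X,Y)+\mathrm{Ric}^\nabla(Y,X)\bigr)=\tfrac1n\,\mathrm{scal}^\nabla_{g'}\,g'(X,Y),$$ where $R^\nabla(X,Y)Z=\nabla_{[X,Y]}Z-\nabla_X\nabla_YZ+\nabla_Y\nabla_XZ$, $\mathrm{Ric}^\nabla(X,Y)=\mathrm{Tr}(Z\mapsto R^\nabla(X,Z)Y)$, and $\mathrm{scal}^\nabla_{g'}$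 is the $g'$-trace of $\mathrm{Ric}^\nabla$. Let $\nabla$ be a left-invariant Weyl-Einstein structure on $(G,c)$, and assume that its Lee form $\theta$ with respect to $g$ is not zero. Then there is a smooth function $f:G\to\mathbb R$ with $df=\theta$, and for every such $f$ the Riemannian metric $h:=e^{2f}g$ is Ricci-flat. Moreover, let $b\in\mathfrak g$ be a $g$-unit vector orthogonal to $\mathfrak h$, and let $A$ and $S$ be the skew-symmetric and the symmetric part, with respect to $g$, of $\operatorname{ad}_b|_{\mathfrak h}:\mathfrak h\to\mathfrak h$. Then $h$ is flat if and only if either $S=k\,\mathrm{Id}_{\mathfrak h}$ for some $k\in\mathbb R$, or there is a subspace $U\subset\mathfrak h$ of codimension $1$ in $\mathfrak h$ such that $S|_U=\alpha\,\mathrm{Id}_U$ for some $\alpha\in\mathbb R$ and $S|_{U^\perp}=0$, where $U^\perp$ is the $g$-orthogonal complement of $U$ in $\mathfrak h$. -/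

import Mathlib

open scoped Manifold ContDiff Bundle

noncomputable section

namespace WeylGeometry

/-- Makes the Lie algebra structure on `GroupLieAlgebra I G` available for smooth real Lie groups. -/
instance instLEInftyMinSmoothness : ENat.LEInfty (minSmoothness ℝ 3) where
  out := by
    rw [minSmoothness_of_isRCLikeNormedField]
    exact ENat.LEInfty.out

section Manifold

variable {E : Type*} [NormedAddCommGroup E] [NormedSpace ℝ E]
  {H : Type*} [TopologicalSpace H] (I : ModelWithCorners ℝ E H)
  (M : Type*) [TopologicalSpace M] [ChartedSpace H M] [IsManifold I ∞ M]

/-- Smooth Riemannian metrics on the manifold `M`. -/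
abbrev Metric : Type _ :=
  Bundle.ContMDiffRiemannianMetric I ∞ E (fun x : M ↦ TangentSpace I x)

/-- Linear connections on `M`; `D Y x u` is the covariant derivative `(∇_u Y)(x)`. Smoothness is
imposed separately, through `ContMDiffCovariantDerivative`. -/
abbrev LinearConnection : Type _ :=
  CovariantDerivative I E (fun x : M ↦ TangentSpace I x)

/-- (Not necessarily continuous) 1-forms on `M`. -/
abbrev OneForm : Type _ := Π x : M, TangentSpace I x →L[ℝ] ℝ

variable {I M}

/-- The Riemannian metric `e^{2f} g`. -/
def conformalChange (g : Metric I M) (f : C^∞⟮I, M; 𝓘(ℝ, ℝ), ℝ⟯) : Metric I M where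
  inner x := Real.exp (2 * f x) • g.inner x
  symm x v w := by
    change Real.exp (2 * f x) * g.inner x v w = Real.exp (2 * f x) * g.inner x w v
    rw [g.symm]
  pos x v hv := mul_pos (Real.exp_pos _) (g.pos x v hv)
  isVonNBounded x := by
    have h := (g.isVonNBounded x).image
      (Real.exp (-f x) • ContinuousLinearMap.id ℝ (TangentSpace I x))
    refine h.subset fun v hv ↦ (Set.mem_image _ _ _).2 ⟨Real.exp (f x) • v, ?_, ?_⟩
    · have h2 : Real.exp (2 * f x) * g.inner x v v < 1 := hv
      simp only [Set.mem_ofPred_eq, map_smul, smul_apply, smul_eq_mul]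
      rwa [← mul_assoc, ← Real.exp_add, ← two_mul]
    · change Real.exp (-f x) • (Real.exp (f x) • v) = v
      rw [smul_smul, ← Real.exp_add]
      simp
  contMDiff := by
    have hf : ContMDiff I 𝓘(ℝ, ℝ) ∞ (fun x ↦ Real.exp (2 * f x)) :=
      (Real.contDiff_exp.comp (contDiff_const.mul contDiff_id)).comp_contMDiff f.contMDiff
    exact hf.smul_section g.contMDiff

/-- Two metrics are conformally equivalent if `h = e^{2f} g` for some smooth function `f`. -/
def ConformallyEquivalent (g h : Metric I M) : Prop :=
  ∃ f : C^∞⟮I, M; 𝓘(ℝ, ℝ), ℝ⟯,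
    ∀ (x : M) (u v : TangentSpace I x), h.inner x u v = Real.exp (2 * f x) * g.inner x u v

variable (I M) in
def conformalSetoid : Setoid (Metric I M) where
  r := ConformallyEquivalent
  iseqv :=
    { refl := fun g ↦ ⟨0, fun x u v ↦ by simp⟩
      symm := by
        rintro g h ⟨f, hf⟩
        refine ⟨-f, fun x u v ↦ ?_⟩
        rw [hf, ← mul_assoc, ← Real.exp_add]
        simp
      trans := by
        rintro g h k ⟨f, hf⟩ ⟨f', hf'⟩
        refine ⟨f + f', fun x u v ↦ ?_⟩
        rw [hf', hf, ← mul_assoc, ← Real.exp_add]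
        congr 2
        simp
        ring }

variable (I M) in
/-- Conformal classes of Riemannian metrics on `M`. -/
def ConformalClass : Type _ := Quotient (conformalSetoid I M)

/-- The metric `g` belongs to the conformal class `c`. -/
def ConformalClass.Contains (c : ConformalClass I M) (g : Metric I M) : Prop :=
  Quotient.mk (conformalSetoid I M) g = c

/-- `(∇_u g)(Y, Z) = u (g(Y, Z)) - g(∇_u Y, Z) - g(Y, ∇_u Z)`, for `u ∈ T_x M`. -/
def covDerivMetric (D : LinearConnection I M) (g : Metric I M)
    (Y Z : Π x : M, TangentSpace I x) (x : M) (u : TangentSpace I x) : ℝ :=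
  mvfderiv I (fun y ↦ g.inner y (Y y) (Z y)) x u
    - g.inner x (D Y x u) (Z x) - g.inner x (Y x) (D Z x u)

/-- `θ` is the Lee form of `D` with respect to `g`, i.e. `∇ g = -2 θ ⊗ g`. -/
def IsLeeForm (D : LinearConnection I M) (g : Metric I M) (θ : OneForm I M) : Prop :=
  ∀ (Y Z : Π x : M, TangentSpace I x) (x : M), MDiffAt (T% Y) x → MDiffAt (T% Z) x →
    ∀ u : TangentSpace I x,
      covDerivMetric D g Y Z x u = -2 * θ x u * g.inner x (Y x) (Z x)

/-- The curvature `R(X, Y) Z = ∇_{[X, Y]} Z - ∇_X ∇_Y Z + ∇_Y ∇_X Z` of vector fields. -/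
def curvatureField (D : LinearConnection I M) (X Y Z : Π x : M, TangentSpace I x) (x : M) :
    TangentSpace I x :=
  D Z x (VectorField.mlieBracket I X Y x)
    - D (fun y ↦ D Z y (Y y)) x (X x) + D (fun y ↦ D Z y (X y)) x (Y x)

/-- The value `R_x(u, v) w` of the curvature tensor at tangent vectors, computed with vector fields
that extend `u`, `v`, `w` and are smooth near `x`. -/
def curvature (D : LinearConnection I M) (x : M) (u v w : TangentSpace I x) : TangentSpace I x :=
  curvatureField D (FiberBundle.extend E u) (FiberBundle.extend E v) (FiberBundle.extend E w) x

variable [FiniteDimensional ℝ E]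

/-- A basis of the tangent space, in which traces are computed. -/
def tangentBasis (x : M) :
    Module.Basis (Fin (Module.finrank ℝ E)) ℝ (TangentSpace I x) :=
  Module.finBasis ℝ E

/-- The Ricci tensor `Ric(u, v) = Tr (w ↦ R(u, w) v)`. -/
def ricci (D : LinearConnection I M) (x : M) (u v : TangentSpace I x) : ℝ :=
  ∑ i, (tangentBasis x).coord i (curvature D x u (tangentBasis x i) v)

/-- The Gram matrix of `g` at `x`. -/
def gram (g : Metric I M) (x : M) :
    Matrix (Fin (Module.finrank ℝ E)) (Fin (Module.finrank ℝ E)) ℝ :=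
  Matrix.of fun i j ↦ g.inner x (tangentBasis x i) (tangentBasis x j)

/-- The scalar curvature of `D` with respect to `g`: the `g`-trace `g^{ij} Ric_{ij}` of the Ricci
tensor of `D`. -/
def scalarCurvature (D : LinearConnection I M) (g : Metric I M) (x : M) : ℝ :=
  ∑ i, ∑ j, (gram g x)⁻¹ i j * ricci D x (tangentBasis x i) (tangentBasis x j)

variable [CompleteSpace E]

/-- A Weyl structure on `(M, c)`: a smooth torsion-free linear connection preserving `c`, that is,
for every metric `g` in `c` there is a 1-form `θ` with `∇ g = -2 θ ⊗ g`. -/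
structure IsWeylStructure (c : ConformalClass I M) (D : LinearConnection I M) : Prop where
  smooth : D.ContMDiffCovariantDerivative ∞
  torsion_eq_zero : D.torsion = 0
  exists_leeForm : ∀ g : Metric I M, c.Contains g → ∃ θ : OneForm I M, IsLeeForm D g θ

/-- The Weyl-Einstein condition: the trace-free part of the symmetrised Ricci tensor vanishes,
`Ric^sym = (1/n) scal_g g` for some metric `g ∈ c`. -/
def IsWeylEinstein (c : ConformalClass I M) (D : LinearConnection I M) : Prop :=
  ∃ g : Metric I M, c.Contains g ∧ ∀ (x : M) (u v : TangentSpace I x),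
    (ricci D x u v + ricci D x v u) / 2
      = scalarCurvature D g x / Module.finrank ℝ E * g.inner x u v

/-- `D` is the Levi-Civita connection of `g`. -/
structure IsLeviCivita (g : Metric I M) (D : LinearConnection I M) : Prop where
  smooth : D.ContMDiffCovariantDerivative ∞
  torsion_eq_zero : D.torsion = 0
  metric : ∀ (Y Z : Π x : M, TangentSpace I x) (x : M), MDiffAt (T% Y) x → MDiffAt (T% Z) x →
    ∀ u : TangentSpace I x, covDerivMetric D g Y Z x u = 0

/-- The Ricci tensor of the (unique) Levi-Civita connection of `g` vanishes. -/
def IsRicciFlat (g : Metric I M) : Prop :=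
  ∃ D : LinearConnection I M, IsLeviCivita g D ∧
    ∀ (x : M) (u v : TangentSpace I x), ricci D x u v = 0

/-- The curvature tensor of the (unique) Levi-Civita connection of `g` vanishes. -/
def IsFlat (g : Metric I M) : Prop :=
  ∃ D : LinearConnection I M, IsLeviCivita g D ∧
    ∀ (x : M) (u v w : TangentSpace I x), curvature D x u v w = 0

end Manifold

section LieGroup

variable {E : Type*} [NormedAddCommGroup E] [NormedSpace ℝ E]
  {H : Type*} [TopologicalSpace H] {I : ModelWithCorners ℝ E H}
  {G : Type*} [TopologicalSpace G] [ChartedSpace H G] [Group G] [LieGroup I ∞ G]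

def IsLeftInvariantMetric (g : Metric I G) : Prop :=
  ∀ (a x : G) (u v : TangentSpace I x),
    g.inner (a * x) (mfderiv I I (fun y ↦ a * y) x u) (mfderiv I I (fun y ↦ a * y) x v)
      = g.inner x u v

def IsLeftInvariantForm (θ : OneForm I G) : Prop :=
  ∀ (a x : G) (u : TangentSpace I x), θ (a * x) (mfderiv I I (fun y ↦ a * y) x u) = θ x u

/-- The Lee form of `D` with respect to any left-invariant metric in `c` is left-invariant. -/
def IsLeftInvariantWeyl (c : ConformalClass I G) (D : LinearConnection I G) : Prop :=
  ∀ g : Metric I G, c.Contains g → IsLeftInvariantMetric g →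
    ∀ θ : OneForm I G, IsLeeForm D g θ → IsLeftInvariantForm θ

/-- The inner product induced on the Lie algebra (the tangent space at `1`) by a metric on `G`. -/
def lieInner (g : Metric I G) (u v : GroupLieAlgebra I G) : ℝ := g.inner (1 : G) u v

variable [CompleteSpace E]

/-- `b` is a `g`-unit vector orthogonal to `𝔥`. -/
structure IsUnitNormal (g : Metric I G) (𝔥 : LieIdeal ℝ (GroupLieAlgebra I G))
    (b : GroupLieAlgebra I G) : Prop where
  unit : lieInner g b b = 1
  orthogonal : ∀ u : 𝔥, lieInner g b u = 0

/-- `A` and `S` are the skew-symmetric and the symmetric part, with respect to `g`, of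
`ad_b : 𝔥 → 𝔥`. -/
structure IsAssociatedPair (g : Metric I G) (𝔥 : LieIdeal ℝ (GroupLieAlgebra I G))
    (b : GroupLieAlgebra I G) (A S : 𝔥 →ₗ[ℝ] 𝔥) : Prop where
  skew : ∀ u v : 𝔥, lieInner g (A u) v = -lieInner g u (A v)
  symm : ∀ u v : 𝔥, lieInner g (S u) v = lieInner g u (S v)
  add : ∀ u : 𝔥, ⁅b, (u : GroupLieAlgebra I G)⁆
    = (A u : GroupLieAlgebra I G) + (S u : GroupLieAlgebra I G)

end LieGroup

end WeylGeometry

end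

/-! A left-invariant metric splits the Lie algebra as ℝ b ⊕ V with V Euclidean, and Koszul's
argument identifies the Weyl connection, in a left-invariant frame, with the explicit bilinear map
`weylModel` in A, S and the Lee form (t, v). Ricci and curvature thereby become algebra.

Let σ_i be the eigenvalues of S and put m = dim V, s = Σ σ_i, Q = Σ σ_i², W = |v|². The diagonal
Einstein equations, summed with weights 1, σ_i and v_i², together with the mixed equation at (b, v),
become polynomial relations in s, Q, W, t and Σ v_i⁴. Cauchy-Schwarz excludes t = 0, and Σ v_i⁴ ≤ W²
excludes W > 0. What remains is v = 0, Einstein constant 0, Q = t s, and s = m t or s = (m - 1) t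
(`weylEinstein_scalars`).

For v = 0 the curvature is built from the symmetric operators C = [S, A] + (S - t) S and S - t, so
the Ricci tensor is symmetric and vanishes entirely. If s = m t then S = t Id; if s = (m - 1) t,
Ricci-flatness on V says [S, A] = 0. Either way S and A commute (`weylEinstein_model`), and flatness
means that S² = t S and S - t has rank at most one: every eigenvalue is t, except possibly a single
0. Conversely, Q = t s and s ≠ 0 force the constant in the flatness criterion to be t
(`curvatureModel_eq_zero_iff`).

Since v = 0 and s ≠ 0, θ is a multiple of X ↦ tr ad_X, the differential at 1 of the homomorphism log
|det Ad|; hence θ = df (`IsFrameConnection.exists_primitive`). Then ∇ preserves e^{2f} g, so it is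
the Levi-Civita connection of h, and its curvature is that of the model. -/

noncomputable section

set_option linter.unusedSectionVars false

namespace WeylGeometry

/-! ### Scalar consequences of the Einstein equations -/

section Numeric

open Finset

/-- The scalar identities satisfied by a left-invariant Weyl-Einstein structure, in an orthonormal
basis that diagonalises the symmetric part of the adjoint action. -/
theorem weylEinstein_scalars {ι : Type*} [Fintype ι] (hm : 2 ≤ Fintype.card ι)
    (σ v : ι → ℝ) (t μ : ℝ)
    (hb : -(∑ i, σ i ^ 2) + t * (∑ i, σ i) - (Fintype.card ι - 1) * (∑ i, v i ^ 2) = μ)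
    (hi : ∀ i, -(∑ j, σ j) * σ i + (Fintype.card ι - 1) * t * σ i
      + (Fintype.card ι - 1) * v i ^ 2 + t * (∑ j, σ j)
      - (Fintype.card ι - 1) * (t ^ 2 + ∑ j, v j ^ 2) = μ)
    (hbx : ∑ i, σ i * v i ^ 2 = 2 * t * ∑ i, v i ^ 2)
    (hne : t ≠ 0 ∨ ∑ i, v i ^ 2 ≠ 0) :
    t ≠ 0 ∧ ∑ i, v i ^ 2 = 0 ∧ ∑ i, σ i ^ 2 = t * ∑ i, σ i ∧
      (∑ i, σ i - Fintype.card ι * t) * (∑ i, σ i - (Fintype.card ι - 1) * t) = 0 ∧ μ = 0 := by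
  have hm' : (2 : ℝ) ≤ Fintype.card ι := by exact_mod_cast hm
  have hcs : (∑ i, σ i) ^ 2 ≤ Fintype.card ι * ∑ i, σ i ^ 2 := by
    simpa using sq_sum_le_card_mul_sum_sq (s := (univ : Finset ι)) (f := σ)
  have h4 : ∑ i, v i ^ 4 ≤ (∑ i, v i ^ 2) ^ 2 := by
    rw [sq, sum_mul]
    refine sum_le_sum fun i _ ↦ ?_
    have : v i ^ 2 ≤ ∑ j, v j ^ 2 :=
      single_le_sum (f := fun j ↦ v j ^ 2) (fun j _ ↦ sq_nonneg _) (mem_univ i)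
    nlinarith [sq_nonneg (v i)]
  have hW : 0 ≤ ∑ i, v i ^ 2 := sum_nonneg fun i _ ↦ sq_nonneg _
  -- The equations `hi` are summed with weights 1, σ i and v i ^ 2. By `hbx`, only s, Q, W and F = Σ
  -- v i ^ 4 survive besides t and μ.
  have e1 := sum_congr rfl fun i (_ : i ∈ univ) ↦ hi i
  have e2 := sum_congr rfl fun i (_ : i ∈ univ) ↦ congrArg (σ i * ·) (hi i)
  have e3 := sum_congr rfl fun i (_ : i ∈ univ) ↦ congrArg (v i ^ 2 * ·) (hi i)
  simp only [mul_sub, mul_add, sum_sub_distrib, sum_add_distrib] at e1 e2 e3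
  generalize hs : ∑ i, σ i = s at *
  generalize hQ : ∑ i, σ i ^ 2 = Q at *
  generalize hV : ∑ i, v i ^ 2 = W at *
  generalize hF : ∑ i, v i ^ 4 = F at *
  generalize hmm : (Fintype.card ι : ℝ) = m at *
  have e1' : -s ^ 2 + (m - 1) * t * s + (m - 1) * W + m * (t * s) - m * ((m - 1) * (t ^ 2 + W))
      = m * μ := by
    have := e1
    simp only [← mul_sum, sum_const, card_univ, nsmul_eq_mul, hs, hV, hmm] at this
    linear_combination this
  have e2' : -s * Q + (m - 1) * t * Q + (m - 1) * (2 * t * W) + s * (t * s)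
      - s * ((m - 1) * (t ^ 2 + W)) = s * μ := by
    have h1 : ∑ i, σ i * (-s * σ i) = -s * Q := by
      rw [← hQ, mul_sum]; exact sum_congr rfl fun i _ ↦ by ring
    have h2 : ∑ i, σ i * ((m - 1) * t * σ i) = (m - 1) * t * Q := by
      rw [← hQ, mul_sum]; exact sum_congr rfl fun i _ ↦ by ring
    have h3 : ∑ i, σ i * ((m - 1) * v i ^ 2) = (m - 1) * (2 * t * W) := by
      rw [← hbx, mul_sum]; exact sum_congr rfl fun i _ ↦ by ring
    simp only [h1, h2, h3, ← sum_mul, hs] at e2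
    linear_combination e2
  have e3' : -s * (2 * t * W) + (m - 1) * t * (2 * t * W) + (m - 1) * F + W * (t * s)
      - W * ((m - 1) * (t ^ 2 + W)) = W * μ := by
    have h1 : ∑ i, v i ^ 2 * (-s * σ i) = -s * (2 * t * W) := by
      rw [← hbx, mul_sum]; exact sum_congr rfl fun i _ ↦ by ring
    have h2 : ∑ i, v i ^ 2 * ((m - 1) * t * σ i) = (m - 1) * t * (2 * t * W) := by
      rw [← hbx, mul_sum]; exact sum_congr rfl fun i _ ↦ by ring
    have h3 : ∑ i, v i ^ 2 * ((m - 1) * v i ^ 2) = (m - 1) * F := by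
      rw [← hF, mul_sum]; exact sum_congr rfl fun i _ ↦ by ring
    simp only [h1, h2, h3, ← sum_mul, hV] at e3
    linear_combination e3
  clear e1 e2 e3 hi hbx
  -- For t = 0, `e1'` and m times `hb` combine to (m Q - s²) + (m - 1) W = 0, where both summands
  -- are nonnegative by Cauchy-Schwarz; so W = 0.
  have ht : t ≠ 0 := by
    rintro rfl
    have h0 : W = 0 := by
      have : m * Q - s ^ 2 + (m - 1) * W = 0 := by rw [← hb] at e1'; linear_combination e1'
      nlinarith
    simp [h0] at hne
  have hQ' : Q = s * t - 2 * W := by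
    have h : (m - 1) * t * (Q + 2 * W - s * t) = 0 := by rw [← hb] at e2'; linear_combination e2'
    have h' : (m - 1) * t ≠ 0 := mul_ne_zero (by linarith) ht
    linarith [(mul_eq_zero.1 h).resolve_left h']
  -- In this variable the two admissible values of s are r = 0 and r = t.
  obtain ⟨r, hr⟩ : ∃ r, r = s - (m - 1) * t := ⟨_, rfl⟩
  have hs' : s = r + (m - 1) * t := by linarith
  subst hQ' hs' hb
  have k1 : r * (r - t) = -(m + 1) * W := by linear_combination -e1'
  have k2 : (m - 1) * F = 2 * W ^ 2 + r * t * W := by linear_combination e3'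
  -- If W > 0, `h4` and `k2` give r t ≤ (m - 3) W, while `k1` gives r (t - r) = (m + 1) W > 0, so r²
  -- < r t. Eliminating W yields 4 r t + (m - 3) r² ≤ 0, which is impossible even for m = 2 because
  -- r² < r t.
  have hW0 : W = 0 := by
    by_contra hne'
    have hpos : 0 < W := lt_of_le_of_ne hW (Ne.symm hne')
    have k3 : 2 * W + r * t ≤ (m - 1) * W := by
      have : (2 * W + r * t) * W ≤ ((m - 1) * W) * W := by
        have := mul_le_mul_of_nonneg_left h4 (by linarith : (0 : ℝ) ≤ m - 1)
        nlinarith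
      exact le_of_mul_le_mul_right this hpos
    have k4 : (m + 1) * (r * t) ≤ (m - 3) * (r * (t - r)) := by
      have := mul_le_mul_of_nonneg_left k3 (by linarith : (0 : ℝ) ≤ m + 1)
      have k1' : r * (t - r) = (m + 1) * W := by linear_combination -k1
      rw [k1']; nlinarith
    have k5 : 0 < r * (t - r) := by nlinarith
    have k6 : r ^ 2 < r * t := by nlinarith
    nlinarith [sq_nonneg r]
  subst hW0
  refine ⟨ht, rfl, by ring, ?_, by ring⟩
  linear_combination k1

end Numeric

/-! ### Curvature of the algebraic model ℝ b ⊕ V -/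

section Model

open scoped RealInnerProductSpace

variable {V : Type*} [NormedAddCommGroup V] [InnerProductSpace ℝ V]

/-- The left-invariant Weyl connection on `ℝ b ⊕ V`, with `ad_b = A + S` on the abelian ideal `V`
and Lee form `(p, x) ↦ t p + ⟪v, x⟫`. -/
def weylModel (A S : V →ₗ[ℝ] V) (t : ℝ) (v : V) (X Y : ℝ × V) : ℝ × V :=
  (X.1 * Y.1 * t + X.1 * ⟪v, Y.2⟫ + Y.1 * ⟪v, X.2⟫ + ⟪S X.2, Y.2⟫ - t * ⟪X.2, Y.2⟫,
    -(X.1 * Y.1) • v + X.1 • (A Y.2 + t • Y.2) + Y.1 • (t • X.2 - S X.2)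
      + ⟪v, X.2⟫ • Y.2 + ⟪v, Y.2⟫ • X.2 - ⟪X.2, Y.2⟫ • v)

def bracketModel (A S : V →ₗ[ℝ] V) (X Y : ℝ × V) : ℝ × V :=
  (0, X.1 • (A Y.2 + S Y.2) - Y.1 • (A X.2 + S X.2))

def curvatureModel (A S : V →ₗ[ℝ] V) (t : ℝ) (v : V) (X Y Z : ℝ × V) : ℝ × V :=
  weylModel A S t v (bracketModel A S X Y) Z
    - weylModel A S t v X (weylModel A S t v Y Z) + weylModel A S t v Y (weylModel A S t v X Z)

def ricciModel {ι : Type*} [Fintype ι] (e : OrthonormalBasis ι ℝ V) (A S : V →ₗ[ℝ] V) (t : ℝ)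
    (v : V) (X Y : ℝ × V) : ℝ :=
  (curvatureModel A S t v X (1, 0) Y).1 + ∑ i, ⟪e i, (curvatureModel A S t v X (0, e i) Y).2⟫

variable {ι : Type*} [Fintype ι] (e : OrthonormalBasis ι ℝ V) {A S : V →ₗ[ℝ] V} {t : ℝ} {v : V}

theorem inner_skew_self (hA : ∀ x y, ⟪A x, y⟫ = -⟪x, A y⟫) (x : V) : ⟪x, A x⟫ = 0 := by
  have := hA x x
  rw [real_inner_comm] at this
  linarith

theorem inner_self_eq_sum (v : V) : ⟪v, v⟫ = ∑ i, ⟪v, e i⟫ ^ 2 := by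
  simpa [sq, real_inner_comm] using (e.sum_inner_mul_inner v v).symm

/-- In an eigenbasis of S, skewness of A gives ⟪e i, A (e i)⟫ = 0 and ⟪e i, S (A (e i))⟫ = σ i ⟪e i,
A (e i)⟫ = 0, so A disappears from the diagonal Ricci terms. -/
theorem ricciModel_b_b (hA : ∀ x y, ⟪A x, y⟫ = -⟪x, A y⟫) (hS : ∀ x y, ⟪S x, y⟫ = ⟪x, S y⟫)
    {σ : ι → ℝ} (hσ : ∀ i, S (e i) = σ i • e i) :
    ricciModel e A S t v (1, 0) (1, 0) = -(∑ i, σ i ^ 2) + t * (∑ i, σ i)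
      - (Fintype.card ι - 1) * (∑ i, ⟪v, e i⟫ ^ 2) := by
  have key : ∀ i, ⟪e i, (curvatureModel A S t v (1, 0) (0, e i) (1, 0)).2⟫
      = -σ i ^ 2 + t * σ i + ⟪v, e i⟫ ^ 2 - ⟪v, v⟫ := by
    intro i
    have h1 : ⟪e i, S (A (e i))⟫ = 0 := by
      rw [← hS, hσ, inner_smul_left, inner_skew_self hA, mul_zero]
    simp only [curvatureModel, weylModel, bracketModel, hσ, inner_add_right, inner_sub_right,
      inner_smul_right, inner_skew_self hA, h1, map_add, map_sub, map_smul, map_zero, inner_zero_left,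
      inner_zero_right, Prod.snd_add, Prod.snd_sub,
      real_inner_comm v (e i), real_inner_self_eq_norm_sq, e.norm_eq_one]
    ring
  have h0 : (curvatureModel A S t v (1, 0) (1, 0) (1, 0)).1 = 0 := by
    simp [curvatureModel, weylModel, bracketModel]
  simp only [ricciModel, key, h0, Finset.sum_sub_distrib, Finset.sum_add_distrib,
    Finset.sum_neg_distrib, ← Finset.mul_sum, Finset.sum_const, Finset.card_univ, nsmul_eq_mul,
    inner_self_eq_sum e v]
  ring

theorem ricciModel_e_e {σ : ι → ℝ} (hA : ∀ x y, ⟪A x, y⟫ = -⟪x, A y⟫)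
    (hS : ∀ x y, ⟪S x, y⟫ = ⟪x, S y⟫) (hσ : ∀ i, S (e i) = σ i • e i) (k : ι) :
    ricciModel e A S t v (0, e k) (0, e k) = -(∑ j, σ j) * σ k + (Fintype.card ι - 1) * t * σ k
      + (Fintype.card ι - 1) * ⟪v, e k⟫ ^ 2 + t * (∑ j, σ j)
      - (Fintype.card ι - 1) * (t ^ 2 + ∑ j, ⟪v, e j⟫ ^ 2) := by
  classical
  -- The expression valid for i ≠ k. The curvature vanishes on a repeated pair, so the term i = k
  -- has to be removed from the full sum.
  let c (i : ι) : ℝ := ⟪v, e i⟫ ^ 2 + ⟪v, e k⟫ ^ 2 + t * σ i - σ i * σ k + t * σ k - t ^ 2 - ⟪v, v⟫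
  have key : ∀ i, ⟪e i, (curvatureModel A S t v (0, e k) (0, e i) (0, e k)).2⟫
      = c i - if i = k then c k else 0 := by
    intro i
    have hik : ⟪e k, e i⟫ = if i = k then 1 else 0 := by
      rw [e.inner_eq_ite]; simp only [eq_comm]
    simp only [c, curvatureModel, weylModel, bracketModel, hσ, inner_add_right, inner_sub_right,
      inner_smul_right, inner_smul_left, inner_skew_self hA, map_add, map_sub, map_smul,
      Prod.snd_add, Prod.snd_sub,
      real_inner_comm v (e _), real_inner_self_eq_norm_sq, e.norm_eq_one,
      real_inner_comm (e k) (e i), hik]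
    split_ifs with h
    · subst h
      simp
    · simp
      ring
  have h0 : (curvatureModel A S t v (0, e k) (1, 0) (0, e k)).1
      = -σ k ^ 2 + t * σ k + ⟪v, e k⟫ ^ 2 - ⟪v, v⟫ := by
    have h1 : ⟪S (A (e k)), e k⟫ = 0 := by
      rw [hS, hσ, inner_smul_right, real_inner_comm, inner_skew_self hA, mul_zero]
    have h2 : ⟪A (e k), e k⟫ = 0 := by rw [real_inner_comm, inner_skew_self hA]
    simp [curvatureModel, weylModel, bracketModel, hσ, inner_add_right, inner_sub_right,
      inner_smul_right, inner_smul_left, inner_skew_self hA, h1, h2,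
      inner_add_left]
    ring
  simp only [ricciModel, key, h0, Finset.sum_sub_distrib, Finset.sum_ite_eq', Finset.mem_univ, if_true]
  simp only [c, Finset.sum_sub_distrib, Finset.sum_add_distrib, ← Finset.mul_sum, ← Finset.sum_mul,
    Finset.sum_const, Finset.card_univ, nsmul_eq_mul, inner_self_eq_sum e v]
  ring

/-- Needed at x = v: there the A-term drops by skewness, and the mixed Einstein equation becomes ⟪S
v, v⟫ = 2 t ⟪v, v⟫. -/
theorem ricciModel_b_x (hA : ∀ x y, ⟪A x, y⟫ = -⟪x, A y⟫) (hS : ∀ x y, ⟪S x, y⟫ = ⟪x, S y⟫)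
    {σ : ι → ℝ} (hσ : ∀ i, S (e i) = σ i • e i) (x : V) :
    ricciModel e A S t v (1, 0) (0, x) + ricciModel e A S t v (0, x) (1, 0)
      = - (Fintype.card ι - 1) * (⟪A v, x⟫ + ⟪S v, x⟫ - 2 * t * ⟪v, x⟫) := by
  have key : ∀ i, ⟪e i, (curvatureModel A S t v (1, 0) (0, e i) (0, x)).2⟫
      + ⟪e i, (curvatureModel A S t v (0, x) (0, e i) (1, 0)).2⟫
      = ⟪v, e i⟫ * ⟪e i, S x⟫ + ⟪S v, e i⟫ * ⟪e i, x⟫ - 2 * t * (⟪v, e i⟫ * ⟪e i, x⟫)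
        + (2 * t * ⟪v, x⟫ + ⟪v, A x⟫ - ⟪v, S x⟫) := by
    intro i
    have h1 : ⟪v, A (e i)⟫ = -⟪A v, e i⟫ := by rw [hA, neg_neg]
    have h2 : ⟪S v, e i⟫ = σ i * ⟪v, e i⟫ := by rw [hS, hσ, inner_smul_right]
    have h3 : ⟪e i, S x⟫ = σ i * ⟪x, e i⟫ := by rw [real_inner_comm, hS, hσ, inner_smul_right]
    simp [curvatureModel, weylModel, bracketModel, inner_add_right, inner_sub_right,
      inner_smul_right, inner_smul_left, inner_add_left, inner_skew_self hA,
      real_inner_comm v (e _),  real_inner_comm x (e i), hσ, h1, h2, hA (e i), h3,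
      real_inner_comm (A v) (e i)]
    ring
  have h0 : (curvatureModel A S t v (0, x) (1, 0) (1, 0)).1 = -⟪v, S x⟫ - ⟪v, A x⟫ := by
    simp [curvatureModel, weylModel, bracketModel, inner_add_right, inner_sub_right,
      inner_smul_right, real_inner_comm v]
    ring
  have h1 : (curvatureModel A S t v (1, 0) (1, 0) (0, x)).1 = 0 := by
    simp [curvatureModel, weylModel, bracketModel]
  have h3 := Finset.sum_congr rfl fun i (_ : i ∈ Finset.univ) ↦ key i
  rw [Finset.sum_add_distrib] at h3
  simp only [ricciModel, h0, h1]
  simp only [Finset.sum_sub_distrib, Finset.sum_add_distrib, ← Finset.mul_sum,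
    Finset.sum_const, Finset.card_univ, nsmul_eq_mul, e.sum_inner_mul_inner] at h3
  rw [hA, hS]
  rw [hS] at h3
  linear_combination h3

/-- The operator `[S, A] + (S - t) S` that governs the curvature of the model with `v = 0`. -/
def curvatureOperator (A S : V →ₗ[ℝ] V) (t : ℝ) (x : V) : V :=
  S (A x) - A (S x) + S (S x) - t • S x

/-- For v = 0 one has ∇_x b = -(S - t) x on V. Planes inside V therefore contribute a Gauss-type
term in S - t, and planes through b contribute only through C = `curvatureOperator A S t`. -/
theorem curvatureModel_zero (hA : ∀ x y, ⟪A x, y⟫ = -⟪x, A y⟫) (hS : ∀ x y, ⟪S x, y⟫ = ⟪x, S y⟫)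
    (X Y Z : ℝ × V) : curvatureModel A S t 0 X Y Z =
      (⟪curvatureOperator A S t (X.1 • Y.2 - Y.1 • X.2), Z.2⟫,
        -Z.1 • curvatureOperator A S t (X.1 • Y.2 - Y.1 • X.2)
          + ⟪S Y.2 - t • Y.2, Z.2⟫ • (S X.2 - t • X.2)
          - ⟪S X.2 - t • X.2, Z.2⟫ • (S Y.2 - t • Y.2)) := by
  obtain ⟨p, x⟩ := X
  obtain ⟨q, y⟩ := Y
  obtain ⟨r, z⟩ := Z
  have h1 : ⟪x, S y⟫ = ⟪y, S x⟫ := by rw [real_inner_comm, hS]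
  have h2 : ⟪x, S (S y)⟫ = ⟪y, S (S x)⟫ := by rw [← hS, real_inner_comm, hS]
  ext
  · simp [curvatureModel, weylModel, bracketModel, curvatureOperator, inner_add_right,
      inner_sub_right, inner_smul_right, inner_smul_left, inner_add_left, inner_sub_left, hA, hS,
      h1, h2, real_inner_comm x y]
    ring
  · simp [curvatureModel, weylModel, bracketModel, curvatureOperator, inner_add_right,
      inner_sub_right, inner_smul_right, inner_smul_left, inner_add_left, inner_sub_left]
    module

theorem ricciModel_zero (hA : ∀ x y, ⟪A x, y⟫ = -⟪x, A y⟫) (hS : ∀ x y, ⟪S x, y⟫ = ⟪x, S y⟫)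
    {σ : ι → ℝ} (hσ : ∀ i, S (e i) = σ i • e i) (X Y : ℝ × V) :
    ricciModel e A S t 0 X Y = -X.1 * Y.1 * (∑ i, σ i ^ 2 - t * ∑ i, σ i)
      - ⟪curvatureOperator A S t X.2, Y.2⟫ + ⟪S X.2 - t • X.2, S Y.2 - t • Y.2⟫
      - (∑ i, σ i - Fintype.card ι * t) * ⟪S X.2 - t • X.2, Y.2⟫ := by
  obtain ⟨p, x⟩ := X
  obtain ⟨q, y⟩ := Y
  have hC (i : ι) : ⟪e i, curvatureOperator A S t (e i)⟫ = σ i ^ 2 - t * σ i := by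
    have h1 : ⟪e i, S (A (e i))⟫ = 0 := by
      rw [← hS, hσ, inner_smul_left, inner_skew_self hA, mul_zero]
    simp [curvatureOperator, hσ, inner_add_right, inner_sub_right, inner_smul_right, h1,
      inner_skew_self hA, sq]
  have hCs (c : ℝ) (z : V) : curvatureOperator A S t (c • z) = c • curvatureOperator A S t z := by
    simp [curvatureOperator]; module
  have hP (i : ι) (z : V) : ⟪S (e i) - t • e i, z⟫ = ⟪e i, S z - t • z⟫ := by
    simp [inner_sub_left, inner_sub_right, inner_smul_left, inner_smul_right, hS]
  have key (i : ι) : ⟪e i, (curvatureModel A S t 0 (p, x) (0, e i) (q, y)).2⟫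
      = -q * p * (σ i ^ 2 - t * σ i) + ⟪S x - t • x, e i⟫ * ⟪e i, S y - t • y⟫
        - ⟪S x - t • x, y⟫ * (σ i - t) := by
    rw [curvatureModel_zero hA hS]
    have h1 : ⟪e i, S (e i) - t • e i⟫ = σ i - t := by
      rw [hσ, ← sub_smul, inner_smul_right]; simp
    simp only [zero_smul, sub_zero, hCs]
    rw [inner_sub_right, inner_add_right, inner_smul_right, inner_smul_right, inner_smul_right,
      inner_smul_right, hC, hP, h1, real_inner_comm (S x - t • x) (e i)]
    ring
  simp only [ricciModel, key, Finset.sum_sub_distrib, Finset.sum_add_distrib, ← Finset.mul_sum,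
    Finset.sum_const, Finset.card_univ, nsmul_eq_mul, e.sum_inner_mul_inner]
  rw [curvatureModel_zero hA hS]
  simp [curvatureOperator, inner_sub_left, inner_add_left]
  ring

/-- A left-invariant Weyl-Einstein structure with non-zero Lee form on the model has Lee form
vanishing on the ideal and vanishing Ricci tensor. -/
theorem weylEinstein_model (hm : 2 ≤ Fintype.card ι) (hA : ∀ x y, ⟪A x, y⟫ = -⟪x, A y⟫)
    (hS : ∀ x y, ⟪S x, y⟫ = ⟪x, S y⟫) {σ : ι → ℝ} (hσ : ∀ i, S (e i) = σ i • e i) {μ : ℝ}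
    (hE : ∀ X Y, ricciModel e A S t v X Y + ricciModel e A S t v Y X
      = 2 * μ * (X.1 * Y.1 + ⟪X.2, Y.2⟫)) (hne : t ≠ 0 ∨ v ≠ 0) :
    v = 0 ∧ t ≠ 0 ∧ (∀ X Y, ricciModel e A S t v X Y = 0) ∧ ∑ i, σ i ^ 2 = t * ∑ i, σ i ∧
      ∑ i, σ i ≠ 0 ∧ ∀ x, S (A x) = A (S x) := by
  have hm' : (2 : ℝ) ≤ Fintype.card ι := by exact_mod_cast hm
  have hvW : v ≠ 0 → ∑ i, ⟪v, e i⟫ ^ 2 ≠ 0 := by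
    rw [← inner_self_eq_sum]; exact fun h ↦ inner_self_ne_zero.2 h
  obtain ⟨ht, hW, hQ, hs, hμ⟩ := weylEinstein_scalars hm σ (fun i ↦ ⟪v, e i⟫) t μ
    (by
      have := hE (1, 0) (1, 0)
      rw [ricciModel_b_b e hA hS hσ] at this
      simp at this
      linarith)
    (fun i ↦ by
      have := hE (0, e i) (0, e i)
      rw [ricciModel_e_e e hA hS hσ] at this
      simp at this
      linarith)
    (by
      have h := hE (1, 0) (0, v)
      rw [ricciModel_b_x e hA hS hσ, real_inner_comm, inner_skew_self hA] at h
      have hne : (Fintype.card ι : ℝ) - 1 ≠ 0 := by linarith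
      have h1 : ⟪S v, v⟫ = ∑ i, σ i * ⟪v, e i⟫ ^ 2 := by
        rw [← e.sum_inner_mul_inner]
        refine Finset.sum_congr rfl fun i _ ↦ ?_
        rw [hS, hσ, inner_smul_right, real_inner_comm v (e i)]
        ring
      rw [← h1, ← inner_self_eq_sum]
      have : ((Fintype.card ι : ℝ) - 1) * (⟪S v, v⟫ - 2 * t * ⟪v, v⟫) = 0 := by
        simp only [inner_zero_left] at h
        linear_combination -h
      linarith [(mul_eq_zero.1 this).resolve_left hne])
    (hne.imp_right hvW)
  have hv : v = 0 := by
    by_contra h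
    exact hvW h hW
  subst hv hμ
  have hCs (x y : V) : ⟪curvatureOperator A S t x, y⟫ = ⟪x, curvatureOperator A S t y⟫ := by
    simp [curvatureOperator, inner_add_right,
      inner_sub_right, inner_smul_right, inner_smul_left, inner_add_left, inner_sub_left, hA, hS]
    ring
  have hPs (x y : V) : ⟪S x - t • x, y⟫ = ⟪x, S y - t • y⟫ := by
    simp [inner_sub_left, inner_sub_right, inner_smul_left, inner_smul_right, hS]
  -- C and S - t are self-adjoint, so the Ricci form is symmetric; the Einstein equation with
  -- constant 0 then kills all of it, not only its symmetric part.
  have hsymm (X Y) : ricciModel e A S t 0 X Y = ricciModel e A S t 0 Y X := by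
    simp only [ricciModel_zero e hA hS hσ]
    rw [hCs, real_inner_comm (curvatureOperator A S t Y.2),
      real_inner_comm (S X.2 - t • X.2) (S Y.2 - t • Y.2), hPs Y.2 X.2,
      real_inner_comm Y.2 (S X.2 - t • X.2)]
    ring
  have hric (X Y) : ricciModel e A S t 0 X Y = 0 := by
    have := hE X Y
    rw [← hsymm X Y] at this
    linarith
  refine ⟨rfl, ht, hric, hQ, ?_, fun x ↦ ?_⟩
  · intro h0
    rw [h0] at hs
    have : (Fintype.card ι : ℝ) * (Fintype.card ι - 1) * (t * t) ≠ 0 :=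
      mul_ne_zero (mul_ne_zero (by linarith) (by linarith)) (mul_ne_zero ht ht)
    exact this (by linear_combination hs)
  · rcases mul_eq_zero.1 hs with h | h
    -- Here Q = t s turns the sum into t s - 2 t s + m t² = -t (s - m t) = 0.
    · have hsq : ∑ i, (σ i - t) ^ 2 = 0 := by
        simp only [sub_sq, Finset.sum_add_distrib, Finset.sum_sub_distrib, ← Finset.mul_sum,
          ← Finset.sum_mul, hQ, Finset.sum_const, Finset.card_univ, nsmul_eq_mul]
        linear_combination -t * h
      have hσt (i : ι) : σ i = t := by
        have := (Finset.sum_eq_zero_iff_of_nonneg fun i _ ↦ sq_nonneg (σ i - t)).1 hsq i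
          (Finset.mem_univ i)
        exact sub_eq_zero.1 (pow_eq_zero_iff two_ne_zero |>.1 this)
      have hSt : S = t • LinearMap.id := e.toBasis.ext fun i ↦ by simp [hσ, hσt]
      simp [hSt]
    -- With s = (m - 1) t and P = S - t, the Ricci operator on V is -C + P² + t P. As P² + t P = (S
    -- - t) S is the part of C without the commutator, only -[S, A] remains.
    · refine ext_inner_right ℝ fun y ↦ ?_
      have h1 := hric (0, x) (0, y)
      rw [ricciModel_zero e hA hS hσ] at h1
      have h2 : ∑ i, σ i = (Fintype.card ι - 1) * t := by linarith
      simp [curvatureOperator, h2,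
        inner_sub_right, inner_smul_right, inner_smul_left, inner_add_left, inner_sub_left] at h1
      rw [hS (S x)] at h1
      have h3 : ⟪S x, S y⟫ = ⟪S (S x), y⟫ := by rw [hS (S x)]
      have h4 : ⟪x, S y⟫ = ⟪S x, y⟫ := by rw [hS]
      rw [h3, h4] at h1
      have h5 : ⟪S x, S y⟫ = ⟪S (S x), y⟫ := by rw [hS (S x)]
      linarith

/-- Planes through b test S² = t S, so eigenvalues lie in {0, t}; planes inside V test (σ i - t) (σ
j - t) = 0 for i ≠ j, so at most one eigenvalue differs from t. -/
theorem curvatureModel_eq_zero_iff [FiniteDimensional ℝ V] (hA : ∀ x y, ⟪A x, y⟫ = -⟪x, A y⟫)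
    (hS : ∀ x y, ⟪S x, y⟫ = ⟪x, S y⟫) {σ : ι → ℝ} (hσ : ∀ i, S (e i) = σ i • e i)
    (hQ : ∑ i, σ i ^ 2 = t * ∑ i, σ i) (hs : ∑ i, σ i ≠ 0) (hSA : ∀ x, S (A x) = A (S x)) :
    (∀ X Y Z, curvatureModel A S t 0 X Y Z = 0) ↔
      (∃ k : ℝ, ∀ u, S u = k • u) ∨
      ∃ U : Submodule ℝ V, Module.finrank ℝ U + 1 = Module.finrank ℝ V ∧
        (∃ α : ℝ, ∀ u ∈ U, S u = α • u) ∧ ∀ w, (∀ u ∈ U, ⟪w, u⟫ = 0) → S w = 0 := by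
  have hC (x : V) : curvatureOperator A S t x = S (S x) - t • S x := by
    simp [curvatureOperator, hSA]
  classical
  have hei (i) : e i ≠ 0 := e.orthonormal.ne_zero i
  constructor
  · intro h
    have h1 (x : V) : S (S x) - t • S x = 0 := by
      have := congrArg Prod.snd (h (1, 0) (0, x) (1, 0))
      rw [curvatureModel_zero hA hS] at this
      have h3 : t • S x - S (S x) = 0 := by simpa [hC] using this
      exact sub_eq_zero.2 (sub_eq_zero.1 h3).symm
    have h2 (i j) (hij : i ≠ j) : (σ i - t) * (σ j - t) = 0 := by
      have := congrArg Prod.snd (h (0, e i) (0, e j) (0, e j))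
      rw [curvatureModel_zero hA hS] at this
      simp only [hσ, ← sub_smul, inner_smul_left] at this
      simpa [e.inner_eq_ite, hij, smul_smul, curvatureOperator, hei, or_comm] using this
    by_cases hall : ∀ i, σ i = t
    · refine .inl ⟨t, fun u ↦ ?_⟩
      have hSt : S = t • LinearMap.id := e.toBasis.ext fun i ↦ by simp [hσ, hall]
      simp [hSt]
    · push Not at hall
      obtain ⟨k, hk⟩ := hall
      have hk0 : σ k = 0 := by
        have := h1 (e k)
        simp only [hσ, map_smul, smul_smul, ← sub_smul, smul_eq_zero, hei, or_false] at this
        have : σ k * (σ k - t) = 0 := by linear_combination this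
        exact (mul_eq_zero.1 this).resolve_right (sub_ne_zero.2 hk)
      have hoth (i) (hi : i ≠ k) : σ i = t :=
        sub_eq_zero.1 ((mul_eq_zero.1 (h2 i k hi)).resolve_right (sub_ne_zero.2 hk))
      refine .inr ⟨(ℝ ∙ e k)ᗮ, ?_, ⟨t, fun u hu ↦ ?_⟩, fun w hw ↦ ?_⟩
      · rw [← Submodule.finrank_add_finrank_orthogonal (ℝ ∙ e k), finrank_span_singleton (hei k),
          add_comm]
      · rw [← e.sum_repr u]
        simp only [map_sum, map_smul, hσ, Finset.smul_sum]
        refine Finset.sum_congr rfl fun i _ ↦ ?_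
        by_cases hi : i = k
        · have : e.repr u i = 0 := by
            rw [e.repr_apply_apply, hi]
            exact Submodule.mem_orthogonal_singleton_iff_inner_right.1 hu
          simp [this]
        · rw [hoth i hi, smul_comm]
      · have hw' : w ∈ (ℝ ∙ e k)ᗮᗮ := by
          rw [Submodule.mem_orthogonal']
          exact hw
        rw [Submodule.orthogonal_orthogonal, Submodule.mem_span_singleton] at hw'
        obtain ⟨c, rfl⟩ := hw'
        simp [hσ, hk0]
  -- When S - t takes values in the line of w, its two products in the Gauss-type term cancel.
  · have main (h1 : ∀ x, S (S x) - t • S x = 0) (w : V) (h2 : ∀ x, ∃ c : ℝ, S x - t • x = c • w) :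
        ∀ X Y Z, curvatureModel A S t 0 X Y Z = 0 := by
      intro X Y Z
      obtain ⟨c, hc⟩ := h2 X.2
      obtain ⟨d, hd⟩ := h2 Y.2
      rw [curvatureModel_zero hA hS, hC, h1, hc, hd]
      simp only [inner_zero_left, smul_zero, zero_add, inner_smul_left]
      ext
      · rfl
      · simp
        module
    -- Summation gives Q = α s; compared with Q = t s and s ≠ 0, this forces α = t.
    have hα (α : ℝ) (h : ∀ i, σ i ^ 2 = α * σ i) : α = t := by
      have : ∑ i, σ i ^ 2 = α * ∑ i, σ i := by
        rw [Finset.mul_sum]; exact Finset.sum_congr rfl fun i _ ↦ h i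
      exact mul_right_cancel₀ hs (this.symm.trans hQ)
    rintro (⟨k, hk⟩ | ⟨U, hU, ⟨α, hUα⟩, hUw⟩)
    · obtain rfl := hα k fun i ↦ by
        have := hσ i
        rw [hk, ← sub_eq_zero, ← sub_smul, smul_eq_zero] at this
        rw [← sub_eq_zero.1 (this.resolve_right (hei i)), sq]
      exact main (by simp [hk]) 0 (by simp [hk])
    · have hdec (x : V) : ∃ u ∈ U, ∃ w ∈ Uᗮ, x = u + w :=
        ⟨_, U.starProjection_apply_mem x, _, U.sub_starProjection_mem_orthogonal x, by
          simp⟩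
      have hUw' (w) (hw : w ∈ Uᗮ) : S w = 0 :=
        hUw w ((Submodule.mem_orthogonal' _ _).1 hw)
      obtain rfl := hα α fun i ↦ by
        obtain ⟨u, hu, w, hw, hx⟩ := hdec (e i)
        have h1 : S (S (e i)) = α • S (e i) := by
          rw [hx, map_add, hUw' w hw, hUα u hu, add_zero, map_smul, hUα u hu]
        simp only [hσ, map_smul, smul_smul] at h1
        rw [← sub_eq_zero, ← sub_smul, smul_eq_zero] at h1
        linear_combination h1.resolve_right (hei i)
      have h1 : Module.finrank ℝ Uᗮ = 1 := by
        have := Submodule.finrank_add_finrank_orthogonal U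
        omega
      obtain ⟨w₀, -, hw₀⟩ := finrank_eq_one_iff'.1 h1
      refine main (fun x ↦ ?_) w₀ fun x ↦ ?_
      · obtain ⟨u, hu, w, hw, rfl⟩ := hdec x
        simp [hUw' w hw, hUα u hu]
      · obtain ⟨u, hu, w, hw, rfl⟩ := hdec x
        obtain ⟨c, hc⟩ := hw₀ ⟨w, hw⟩
        have hc' : c • (w₀ : V) = w := congrArg Subtype.val hc
        refine ⟨-α * c, ?_⟩
        rw [map_add, hUw' w hw, hUα u hu, ← hc']
        module

end Model

/-! ### Vector fields and brackets read in a chart -/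

section Chart

open VectorField

variable {E : Type*} [NormedAddCommGroup E] [NormedSpace ℝ E]
  {H : Type*} [TopologicalSpace H] {I : ModelWithCorners ℝ E H} [I.Boundaryless]
  {M : Type*} [TopologicalSpace M] [ChartedSpace H M] [IsManifold I ∞ M]
  {F : Type*} [NormedAddCommGroup F] [NormedSpace ℝ F]

theorem contMDiffAt_extChartAt_symm' {x₀ : M} {y : E} (hy : y ∈ (extChartAt I x₀).target) :
    ContMDiffAt 𝓘(ℝ, E) I ∞ (extChartAt I x₀).symm y :=
  (contMDiffOn_extChartAt_symm x₀).contMDiffAt ((isOpen_extChartAt_target x₀).mem_nhds hy)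

theorem isInvertible_mfderiv_extChartAt_symm {x₀ : M} {y : E}
    (hy : y ∈ (extChartAt I x₀).target) :
    (mfderiv 𝓘(ℝ, E) I (extChartAt I x₀).symm y).IsInvertible := by
  have := isInvertible_mfderivWithin_extChartAt_symm (I := I) hy
  rwa [I.range_eq_univ, mfderivWithin_univ] at this

/-- The derivative of a function along a vector field, in a chart. -/
theorem fderiv_comp_extChartAt_symm_mpullback {x₀ : M} {y : E}
    (hy : y ∈ (extChartAt I x₀).target) {f : M → F} (V : Π x : M, TangentSpace I x)
    (hf : MDifferentiableAt I 𝓘(ℝ, F) f ((extChartAt I x₀).symm y)) :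
    fderiv ℝ (f ∘ (extChartAt I x₀).symm) y (mpullback 𝓘(ℝ, E) I (extChartAt I x₀).symm V y)
      = mvfderiv I f ((extChartAt I x₀).symm y) (V ((extChartAt I x₀).symm y)) := by
  have h1 := mfderiv_comp_apply y hf
    ((contMDiffAt_extChartAt_symm' hy).mdifferentiableAt (by simp))
    (mpullback 𝓘(ℝ, E) I (extChartAt I x₀).symm V y)
  have h2 : mfderiv 𝓘(ℝ, E) I (extChartAt I x₀).symm y
      (mpullback 𝓘(ℝ, E) I (extChartAt I x₀).symm V y) = V ((extChartAt I x₀).symm y) :=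
    (isInvertible_mfderiv_extChartAt_symm hy).self_apply_inverse _
  rw [h2, mfderiv_eq_fderiv] at h1
  exact h1

variable [CompleteSpace E]

theorem mpullback_extChartAt_symm_mlieBracket {x₀ : M} {y : E}
    (hy : y ∈ (extChartAt I x₀).target) {V W : Π x : M, TangentSpace I x}
    (hV : MDiffAt (T% V) ((extChartAt I x₀).symm y))
    (hW : MDiffAt (T% W) ((extChartAt I x₀).symm y)) :
    mpullback 𝓘(ℝ, E) I (extChartAt I x₀).symm (mlieBracket I V W) y
      = lieBracket ℝ (mpullback 𝓘(ℝ, E) I (extChartAt I x₀).symm V)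
          (mpullback 𝓘(ℝ, E) I (extChartAt I x₀).symm W) y := by
  have h2 : minSmoothness ℝ 2 ≤ ∞ := by
    rw [minSmoothness_of_isRCLikeNormedField]
    exact ENat.LEInfty.out
  have : IsManifold I (minSmoothness ℝ 2) M := .of_le h2
  rw [mpullback_mlieBracket (n := ∞) hV hW (contMDiffAt_extChartAt_symm' hy) h2]
  rw [← mlieBracketWithin_univ, mlieBracketWithin_eq_lieBracketWithin]
  exact congrFun lieBracketWithin_univ y

theorem differentiableAt_mpullback_extChartAt_symm {x₀ : M} {y : E}
    (hy : y ∈ (extChartAt I x₀).target) {V : Π x : M, TangentSpace I x}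
    (hV : MDiffAt (T% V) ((extChartAt I x₀).symm y)) :
    DifferentiableAt ℝ (mpullback 𝓘(ℝ, E) I (extChartAt I x₀).symm V : E → E) y :=
  MDifferentiableAt.differentiableAt <|
    (contMDiff_snd_tangentBundle_modelSpace (n := 1) E 𝓘(ℝ, E)).contMDiffAt.mdifferentiableAt
      one_ne_zero |>.comp y <| hV.mpullback_vectorField (contMDiffAt_extChartAt_symm' hy)
      (isInvertible_mfderiv_extChartAt_symm hy) ENat.LEInfty.out

/-- `[X, Y] f = X (Y f) - Y (X f)`. -/
theorem mvfderiv_mlieBracket {x : M} {f : M → F} (hf : ContMDiffAt I 𝓘(ℝ, F) 2 f x)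
    {X Y : Π x : M, TangentSpace I x} (hX : MDiffAt (T% X) x) (hY : MDiffAt (T% Y) x)
    (hXf : MDiffAt (fun y ↦ mvfderiv I f y (X y)) x)
    (hYf : MDiffAt (fun y ↦ mvfderiv I f y (Y y)) x) :
    mvfderiv I f x (mlieBracket I X Y x) = mvfderiv I (fun y ↦ mvfderiv I f y (Y y)) x (X x)
      - mvfderiv I (fun y ↦ mvfderiv I f y (X y)) x (Y x) := by
  have hy := mem_extChartAt_target (I := I) x
  have hinv : (extChartAt I x).symm (extChartAt I x x) = x := by simp
  have hψ := contMDiffAt_extChartAt_symm' hy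
  have hf' : ContDiffAt ℝ 2 (f ∘ (extChartAt I x).symm) (extChartAt I x x) :=
    contMDiffAt_iff_contDiffAt.1 <| ContMDiffAt.comp_of_eq hf (hψ.of_le ENat.LEInfty.out) hinv
  -- Equality is needed on a neighbourhood because both sides are differentiated once more.
  have hev (V : Π x : M, TangentSpace I x) :
      (fun y ↦ fderiv ℝ (f ∘ (extChartAt I x).symm) y
        (mpullback 𝓘(ℝ, E) I (extChartAt I x).symm V y)) =ᶠ[nhds (extChartAt I x x)]
      (fun y ↦ mvfderiv I f y (V y)) ∘ (extChartAt I x).symm := by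
    have h1 : ∀ᶠ z in nhds x, MDifferentiableAt I 𝓘(ℝ, F) f z := by
      have : IsManifold I 2 M := .of_le (n := ∞) ENat.LEInfty.out
      filter_upwards [(contMDiffAt_iff_contMDiffAt_nhds (by simp)).1 hf] with z hz
      exact hz.mdifferentiableAt (by simp)
    have h2 := hψ.continuousAt.tendsto
    rw [hinv] at h2
    filter_upwards [h2.eventually h1, (isOpen_extChartAt_target x).mem_nhds hy] with y h3 h4
    exact fderiv_comp_extChartAt_symm_mpullback h4 V h3
  have hchart (h : M → F) (hh : MDiffAt h x) (V : Π x : M, TangentSpace I x) :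
      fderiv ℝ (h ∘ (extChartAt I x).symm) (extChartAt I x x)
        (mpullback 𝓘(ℝ, E) I (extChartAt I x).symm V (extChartAt I x x)) = mvfderiv I h x (V x) := by
    rw [fderiv_comp_extChartAt_symm_mpullback hy V (by rwa [hinv]), hinv]
  rw [← hchart f (hf.mdifferentiableAt (by simp)) (mlieBracket I X Y),
    mpullback_extChartAt_symm_mlieBracket hy (by rwa [hinv]) (by rwa [hinv]),
    fderiv_apply_lieBracket hf' (by rw [minSmoothness_of_isRCLikeNormedField])
      (differentiableAt_mpullback_extChartAt_symm hy (by rwa [hinv]))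
      (differentiableAt_mpullback_extChartAt_symm hy (by rwa [hinv])),
    (hev X).fderiv_eq, (hev Y).fderiv_eq, hchart _ hYf, hchart _ hXf]

end Chart

open scoped InnerProductSpace in
/-- A positive definite symmetric bilinear form is isometric to a Euclidean space. -/
theorem exists_linearEquiv_euclideanSpace {W : Type*} [AddCommGroup W] [Module ℝ W]
    [FiniteDimensional ℝ W] (B : W →ₗ[ℝ] W →ₗ[ℝ] ℝ) (hsymm : ∀ u v, B u v = B v u)
    (hpos : ∀ u, u ≠ 0 → 0 < B u u) :
    ∃ Φ : W ≃ₗ[ℝ] EuclideanSpace ℝ (Fin (Module.finrank ℝ W)), ∀ u v, ⟪Φ u, Φ v⟫_ℝ = B u v := by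
  let core : InnerProductSpace.Core ℝ W :=
    { inner := fun u v ↦ B u v
      conj_inner_symm := fun u v ↦ hsymm v u
      re_inner_nonneg := fun u ↦ by
        rcases eq_or_ne u 0 with rfl | hu
        · simp
        · exact (hpos u hu).le
      add_left := fun u v w ↦ by simp
      smul_left := fun u v r ↦ by simp
      definite := fun u hu ↦ by
        by_contra h
        exact (hpos u h).ne' hu }
  let _ : NormedAddCommGroup W := core.toNormedAddCommGroup
  let _ : InnerProductSpace ℝ W := InnerProductSpace.ofCore core.toCore
  exact ⟨(stdOrthonormalBasis ℝ W).repr.toLinearEquiv,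
    fun u v ↦ (stdOrthonormalBasis ℝ W).repr.inner_map_map u v⟩

/-! ### Left-invariant fields, metrics and forms -/

section LeftInvariant

open VectorField

variable {E : Type*} [NormedAddCommGroup E] [NormedSpace ℝ E]
  {H : Type*} [TopologicalSpace H] {I : ModelWithCorners ℝ E H}
  {G : Type*} [TopologicalSpace G] [ChartedSpace H G] [Group G] [LieGroup I ∞ G]

theorem mulInvariantVectorField_one (v : GroupLieAlgebra I G) :
    mulInvariantVectorField v (1 : G) = v := by
  have h : (fun y : G ↦ (1 : G) * y) = id := by ext; simp
  rw [mulInvariantVectorField, h, mfderiv_id]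
  rfl

theorem mulInvariantVectorField_injective (x : G) :
    Function.Injective fun v : GroupLieAlgebra I G ↦ mulInvariantVectorField v x := by
  intro v w h
  have key (u : GroupLieAlgebra I G) :
      (mfderiv I I (fun y ↦ x * y) (1 : G)).inverse (mulInvariantVectorField u (x * 1)) = u := by
    have := congrFun (mpullback_mulInvariantVectorField x u) 1
    rwa [mulInvariantVectorField_one] at this
  have h' : ∀ y, y = x → mulInvariantVectorField v y = mulInvariantVectorField w y := by
    rintro y rfl
    exact h
  rw [← key v, ← key w, h' _ (mul_one x)]

/-- The field is the tangent map of multiplication applied to the smooth family (0 at g, v at 1). -/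
theorem contMDiff_mulInvariantVectorField_infty (v : GroupLieAlgebra I G) :
    CMDiff ∞ (fun x : G ↦ (mulInvariantVectorField v x : TangentBundle I G)) := by
  let fg : G → TangentBundle I G := fun g ↦ Bundle.TotalSpace.mk' E g 0
  have sfg : CMDiff ∞ fg := Bundle.contMDiff_zeroSection _ _
  let fv : G → TangentBundle I G := fun _ ↦ Bundle.TotalSpace.mk' E 1 v
  have sfv : CMDiff ∞ fv := contMDiff_const
  let F₁ : G → (TangentBundle I G × TangentBundle I G) := fun g ↦ (fg g, fv g)
  have S₁ : CMDiff ∞ F₁ := sfg.prodMk sfv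
  let F₂ : (TangentBundle I G × TangentBundle I G) → TangentBundle (I.prod I) (G × G) :=
    (equivTangentBundleProd I G I G).symm
  have S₂ : CMDiff ∞ F₂ := contMDiff_equivTangentBundleProd_symm
  let F₃ : TangentBundle (I.prod I) (G × G) → TangentBundle I G :=
    tangentMap% (fun (p : G × G) ↦ p.1 * p.2)
  have S₃ : CMDiff ∞ F₃ := (contMDiff_mul I ∞).contMDiff_tangentMap (m := ∞) (by simp)
  let S := (S₃.comp S₂).comp S₁
  convert! S with g
  · simp [F₁, F₂, F₃, fg, fv]
  · simp only [Function.comp_apply, tangentMap, F₃, F₂, F₁, fg, fv]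
    rw [mfderiv_prod_eq_add_apply ((contMDiff_mul I ∞).mdifferentiableAt (by simp))]
    simp +instances only [mulInvariantVectorField]
    exact ((congrArg (· + mfderiv I I (fun z ↦ g * z) (1 : G) v)
      (map_zero (mfderiv I I (fun z : G ↦ z * 1) g))).trans (zero_add _)).symm

theorem lieInner_eq {g : Metric I G} (hg : IsLeftInvariantMetric g) (x : G)
    (u v : GroupLieAlgebra I G) :
    g.inner x (mulInvariantVectorField u x) (mulInvariantVectorField v x) = lieInner g u v := by
  have h := hg x 1 u v
  -- The points `x * 1` and `x` index different fibres, so the point is generalised before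
  -- substituting.
  have key : ∀ y : G, y = x → ∀ r : ℝ,
      g.inner y (mfderiv I I (fun y ↦ x * y) 1 u : E) (mfderiv I I (fun y ↦ x * y) 1 v : E) = r →
      g.inner x (mulInvariantVectorField u x) (mulInvariantVectorField v x) = r := by
    rintro y rfl r h
    exact h
  exact key _ (mul_one x) _ h

theorem IsLeftInvariantForm.apply_mulInvariantVectorField {θ : OneForm I G}
    (hθ : IsLeftInvariantForm θ) (x : G) (u : GroupLieAlgebra I G) :
    θ x (mulInvariantVectorField u x) = θ 1 u := by
  have h := hθ x 1 u
  have key : ∀ y : G, y = x → ∀ r : ℝ, θ y (mfderiv I I (fun y ↦ x * y) 1 u : E) = r →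
      θ x (mulInvariantVectorField u x) = r := by
    rintro y rfl r h
    exact h
  exact key _ (mul_one x) _ h

variable [FiniteDimensional ℝ E]

/-- Left translation, as an isomorphism from the Lie algebra to the tangent space at `x`. -/
def leftTranslation (x : G) : GroupLieAlgebra I G ≃ₗ[ℝ] TangentSpace I x :=
  haveI : FiniteDimensional ℝ (GroupLieAlgebra I G) := inferInstanceAs (FiniteDimensional ℝ E)
  haveI : FiniteDimensional ℝ (TangentSpace I x) := inferInstanceAs (FiniteDimensional ℝ E)
  LinearEquiv.ofInjectiveOfFinrankEq
    (mfderiv I I (fun y ↦ x * y) (1 : G) : E →L[ℝ] E).toLinearMap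
    (mulInvariantVectorField_injective x) rfl

theorem leftTranslation_apply (x : G) (v : GroupLieAlgebra I G) :
    leftTranslation x v = mulInvariantVectorField v x := rfl

end LeftInvariant

/-! ### Derivatives of vector-valued functions -/

section Derivative

variable {E : Type*} [NormedAddCommGroup E] [NormedSpace ℝ E]
  {H : Type*} [TopologicalSpace H] {I : ModelWithCorners ℝ E H}
  {M : Type*} [TopologicalSpace M] [ChartedSpace H M]
  {F F' F'' : Type*} [NormedAddCommGroup F] [NormedSpace ℝ F] [NormedAddCommGroup F']
  [NormedSpace ℝ F'] [NormedAddCommGroup F''] [NormedSpace ℝ F'']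

theorem mvfderiv_eq_fderivWithin {f : M → F} {x : M} (hf : MDiffAt f x) :
    DifferentiableWithinAt ℝ (f ∘ (extChartAt I x).symm) (Set.range I) (extChartAt I x x) ∧
      mvfderiv I f x = fderivWithin ℝ (f ∘ (extChartAt I x).symm) (Set.range I)
        (extChartAt I x x) :=
  ⟨((mdifferentiableAt_iff f x).1 hf).2, hf.mfderiv⟩

theorem mvfderiv_bilinear (B : F →L[ℝ] F' →L[ℝ] F'') {f : M → F} {h : M → F'} {x : M}
    (hf : MDiffAt f x) (hh : MDiffAt h x) (u : TangentSpace I x) :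
    mvfderiv I (fun y ↦ B (f y) (h y)) x u
      = B (f x) (mvfderiv I h x u) + B (mvfderiv I f x u) (h x) := by
  have hBd : MDiffAt (fun y ↦ B (f y) (h y)) x :=
    DifferentiableAt.comp_mdifferentiableAt (f := fun y ↦ (f y, h y))
      (B.isBoundedBilinearMap.differentiableAt (f x, h x)) (hf.prodMk_space hh)
  have h1 := B.fderivWithin_of_bilinear (mvfderiv_eq_fderivWithin hf).1 (mvfderiv_eq_fderivWithin hh).1
    (I.uniqueDiffOn _ (by simp))
  rw [(mvfderiv_eq_fderivWithin hBd).2, (mvfderiv_eq_fderivWithin hf).2, (mvfderiv_eq_fderivWithin hh).2]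
  have h2 := congrArg (fun L ↦ L u) h1
  simp only [Function.comp_apply, extChartAt_to_inv] at h2
  exact h2

variable [I.Boundaryless] [IsManifold I ∞ M] [CompleteSpace E]

open VectorField

theorem mdifferentiableAt_mvfderiv_apply {x : M} {f : M → F}
    (hf : ContMDiffAt I 𝓘(ℝ, F) 2 f x) {X : Π x : M, TangentSpace I x} (hX : MDiffAt (T% X) x) :
    MDiffAt (fun y ↦ mvfderiv I f y (X y)) x := by
  have hy := mem_extChartAt_target (I := I) x
  have hinv : (extChartAt I x).symm (extChartAt I x x) = x := by simp
  have hψ := contMDiffAt_extChartAt_symm' hy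
  have hf' : ContDiffAt ℝ 2 (f ∘ (extChartAt I x).symm) (extChartAt I x x) :=
    contMDiffAt_iff_contDiffAt.1 <| ContMDiffAt.comp_of_eq hf (hψ.of_le ENat.LEInfty.out) hinv
  have h1 : DifferentiableAt ℝ (fun y ↦ fderiv ℝ (f ∘ (extChartAt I x).symm) y
      (mpullback 𝓘(ℝ, E) I (extChartAt I x).symm X y)) (extChartAt I x x) :=
    ((hf'.fderiv_right (m := 1) (by norm_num)).differentiableAt (by simp)).clm_apply
      (differentiableAt_mpullback_extChartAt_symm hy (by rwa [hinv]))
  refine (h1.comp_mdifferentiableAt (mdifferentiableAt_extChartAt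
    (mem_chart_source H x))).congr_of_eventuallyEq ?_
  have h2 : ∀ᶠ z in nhds x, MDifferentiableAt I 𝓘(ℝ, F) f z := by
    have : IsManifold I 2 M := .of_le (n := ∞) ENat.LEInfty.out
    filter_upwards [(contMDiffAt_iff_contMDiffAt_nhds (by simp)).1 hf] with z hz
    exact hz.mdifferentiableAt (by simp)
  filter_upwards [h2, extChartAt_source_mem_nhds (I := I) x] with z hz hz'
  have h3 := fderiv_comp_extChartAt_symm_mpullback ((extChartAt I x).map_source hz') X
    (f := f) (by rwa [(extChartAt I x).left_inv hz'])
  rw [(extChartAt I x).left_inv hz'] at h3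
  exact h3.symm

end Derivative

/-! ### Coordinates and connections in a left-invariant frame -/

section LeftInvariant

open VectorField

variable {E : Type*} [NormedAddCommGroup E] [NormedSpace ℝ E]
  {H : Type*} [TopologicalSpace H] {I : ModelWithCorners ℝ E H}
  {G : Type*} [TopologicalSpace G] [ChartedSpace H G] [Group G] [LieGroup I ∞ G]

theorem contMDiffAt_metric {M : Type*} [TopologicalSpace M] [ChartedSpace H M] [IsManifold I ∞ M]
    (g : Metric I M) {Y Z : Π x : M, TangentSpace I x} {x : M} {k : ℕ∞ω} (hk : k ≤ ∞)
    (hY : CMDiffAt k (T% Y) x) (hZ : CMDiffAt k (T% Z) x) :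
    ContMDiffAt I 𝓘(ℝ, ℝ) k (fun y ↦ g.inner y (Y y) (Z y)) x := by
  have : ContMDiffAt I (I.prod 𝓘(ℝ, ℝ)) k
      (fun y ↦ Bundle.TotalSpace.mk' ℝ (E := Bundle.Trivial M ℝ) y (g.inner y (Y y) (Z y))) x :=
    ContMDiffAt.clm_bundle_apply₂ (F₁ := E) (F₂ := E) (g.contMDiff.contMDiffAt.of_le hk) hY hZ
  rw [Bundle.contMDiffAt_totalSpace] at this
  exact this.2

theorem mdifferentiableAt_metric {M : Type*} [TopologicalSpace M] [ChartedSpace H M]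
    [IsManifold I ∞ M]
    (g : Metric I M) {Y Z : Π x : M, TangentSpace I x} {x : M}
    (hY : MDiffAt (T% Y) x) (hZ : MDiffAt (T% Z) x) :
    MDiffAt (fun y ↦ g.inner y (Y y) (Z y)) x := by
  have : MDifferentiableAt I (I.prod 𝓘(ℝ, ℝ))
      (fun y ↦ Bundle.TotalSpace.mk' ℝ (E := Bundle.Trivial M ℝ) y (g.inner y (Y y) (Z y))) x :=
    MDifferentiableAt.clm_bundle_apply₂ (F₁ := E) (F₂ := E)
      (g.contMDiff.contMDiffAt.mdifferentiableAt (by simp)) hY hZ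
  rw [mdifferentiableAt_totalSpace] at this
  exact this.2

variable [FiniteDimensional ℝ E] {W : Type*} [NormedAddCommGroup W] [NormedSpace ℝ W]

/-- Coordinates of tangent vectors in the left-invariant frame. -/
def frameCoord (Φ : GroupLieAlgebra I G ≃ₗ[ℝ] W) (x : G) : TangentSpace I x ≃ₗ[ℝ] W :=
  (leftTranslation x).symm.trans Φ

theorem frameCoord_symm_apply (Φ : GroupLieAlgebra I G ≃ₗ[ℝ] W) (x : G) (w : W) :
    (frameCoord Φ x).symm w = mulInvariantVectorField (Φ.symm w) x := rfl

theorem lieInner_isometry {g : Metric I G} : ∃ ψ : GroupLieAlgebra I G ≃ₗ[ℝ]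
    EuclideanSpace ℝ (Fin (Module.finrank ℝ E)), ∀ u v, inner ℝ (ψ u) (ψ v) = lieInner g u v := by
  have : FiniteDimensional ℝ (GroupLieAlgebra I G) := inferInstanceAs (FiniteDimensional ℝ E)
  exact exists_linearEquiv_euclideanSpace (W := GroupLieAlgebra I G)
    (LinearMap.mk₂ ℝ (lieInner g) (by simp [lieInner]) (by simp [lieInner]) (by simp [lieInner])
      (by simp [lieInner])) (fun u v ↦ g.symm 1 u v) (fun u hu ↦ g.pos 1 u hu)

/-- Coordinates are read off from g-inner products with a left-invariant orthonormal frame, so their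
regularity is inherited from the metric and the frame. -/
theorem frameCoord_eq_sum {g : Metric I G} (hg : IsLeftInvariantMetric g)
    (Φ : GroupLieAlgebra I G ≃ₗ[ℝ] W) : ∃ (X : Fin (Module.finrank ℝ E) → GroupLieAlgebra I G),
    ∀ (x : G) (u : TangentSpace I x),
      frameCoord Φ x u = ∑ i, g.inner x (mulInvariantVectorField (X i) x) u • Φ (X i) := by
  obtain ⟨ψ, hψ⟩ := lieInner_isometry (g := g)
  let e := EuclideanSpace.basisFun (Fin (Module.finrank ℝ E)) ℝ
  refine ⟨fun i ↦ ψ.symm (e i), fun x u ↦ ?_⟩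
  obtain ⟨v, rfl⟩ := (leftTranslation x).surjective u
  have h1 (i) : g.inner x (mulInvariantVectorField (ψ.symm (e i)) x) (leftTranslation x v)
      = inner ℝ (e i) (ψ v) := by
    rw [leftTranslation_apply, lieInner_eq hg, ← hψ, ψ.apply_symm_apply]
  have h2 : v = ∑ i, inner ℝ (e i) (ψ v) • ψ.symm (e i) := by
    apply ψ.injective
    simp only [map_sum, map_smul, ψ.apply_symm_apply]
    exact (e.sum_repr' (ψ v)).symm
  have h3 : frameCoord Φ x (leftTranslation x v) = Φ v := by simp [frameCoord]
  simp only [h1]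
  conv_lhs => rw [h3, h2]
  simp only [map_sum, map_smul]

variable {g : Metric I G} (Φ : GroupLieAlgebra I G ≃ₗ[ℝ] W)

theorem contMDiffAt_frameCoord (hg : IsLeftInvariantMetric g) {Z : Π x : G, TangentSpace I x}
    {x : G} {k : ℕ∞ω} (hk : k ≤ ∞) (hZ : CMDiffAt k (T% Z) x) :
    ContMDiffAt I 𝓘(ℝ, W) k (fun y ↦ frameCoord Φ y (Z y)) x := by
  obtain ⟨X, hX⟩ := frameCoord_eq_sum hg Φ
  simp only [hX]
  have h (i) : ContMDiffAt I 𝓘(ℝ, W) k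
      (fun y ↦ g.inner y (mulInvariantVectorField (X i) y) (Z y) • Φ (X i)) x :=
    (contMDiffAt_metric g hk
      ((contMDiff_mulInvariantVectorField_infty (X i)).contMDiffAt.of_le hk) hZ).smul
      contMDiffAt_const
  exact ContMDiffAt.sum fun i _ ↦ h i

theorem mdifferentiableAt_frameCoord (hg : IsLeftInvariantMetric g)
    {Z : Π x : G, TangentSpace I x} {x : G} (hZ : MDiffAt (T% Z) x) :
    MDiffAt (fun y ↦ frameCoord Φ y (Z y)) x := by
  obtain ⟨X, hX⟩ := frameCoord_eq_sum hg Φ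
  simp only [hX]
  have h (i) : MDiffAt (fun y ↦ g.inner y (mulInvariantVectorField (X i) y) (Z y) • Φ (X i)) x :=
    MDifferentiableAt.smul (mdifferentiableAt_metric g
      ((contMDiff_mulInvariantVectorField_infty (X i)).contMDiffAt.mdifferentiableAt (by simp)) hZ)
      mdifferentiableAt_const
  have h2 := MDifferentiableAt.sum (t := Finset.univ) fun i _ ↦ h i
  convert h2 using 1
  ext y
  simp

/-- Used for the field ∇_V Z, whose differentiability is known only through its coordinates. -/
theorem mdifferentiableAt_of_frameCoord {Z : Π x : G, TangentSpace I x} {x : G}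
    (hZ : MDiffAt (fun y ↦ frameCoord Φ y (Z y)) x) : MDiffAt (T% Z) x := by
  have hW : FiniteDimensional ℝ (GroupLieAlgebra I G) := inferInstanceAs (FiniteDimensional ℝ E)
  have : FiniteDimensional ℝ W := Φ.finiteDimensional
  let b := Module.finBasis ℝ W
  have h (i) : MDiffAt (T% (fun y ↦ b.coord i (frameCoord Φ y (Z y)) •
      mulInvariantVectorField (I := I) (Φ.symm (b i)) y)) x :=
    MDifferentiableAt.smul_section
      ((b.coord i).toContinuousLinearMap.differentiableAt.comp_mdifferentiableAt hZ)
      ((contMDiff_mulInvariantVectorField_infty _).contMDiffAt.mdifferentiableAt (by simp))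
  have h2 := MDifferentiableAt.sum_section (s := Finset.univ) fun i _ ↦ h i
  convert h2 using 3 with y
  apply (frameCoord Φ y).injective
  rw [map_sum]
  simp only [map_smul, ← frameCoord_symm_apply, LinearEquiv.apply_symm_apply]
  exact (b.sum_repr _).symm

variable [I.Boundaryless] {D : LinearConnection I G} {Γ : W →L[ℝ] W →L[ℝ] W}

/-- The connection `D` is `d + Γ` in the left-invariant frame. -/
def IsFrameConnection (D : LinearConnection I G) (Φ : GroupLieAlgebra I G ≃ₗ[ℝ] W)
    (Γ : W →L[ℝ] W →L[ℝ] W) : Prop :=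
  ∀ (x : G) (X Y : GroupLieAlgebra I G),
    frameCoord Φ x (D (mulInvariantVectorField Y) x (mulInvariantVectorField X x)) = Γ (Φ X) (Φ Y)

/-- `D` and d + Γ obey the same Leibniz rule, so their difference is tensorial in Z. It vanishes on
left-invariant fields, which realise every vector at x. -/
theorem IsFrameConnection.apply (hg : IsLeftInvariantMetric g) (hD : IsFrameConnection D Φ Γ)
    {Z : Π x : G, TangentSpace I x} {x : G} (hZ : MDiffAt (T% Z) x) (u : TangentSpace I x) :
    frameCoord Φ x (D Z x u) = mvfderiv I (fun y ↦ frameCoord Φ y (Z y)) x u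
      + Γ (frameCoord Φ x u) (frameCoord Φ x (Z x)) := by
  let Ψ (σ : Π x : G, TangentSpace I x) : W := frameCoord Φ x (D σ x u)
    - mvfderiv I (fun y ↦ frameCoord Φ y (σ y)) x u - Γ (frameCoord Φ x u) (frameCoord Φ x (σ x))
  have hΨ : TensorialAt I E Ψ x :=
    { smul := fun {f σ} hf hσ ↦ by
        have h1 := D.isCovariantDerivativeOnUniv.leibniz hσ hf
        have h2 := mvfderiv_smul hf (mdifferentiableAt_frameCoord Φ hg hσ)
        have h3 : (fun y ↦ frameCoord Φ y ((f • σ) y)) = f • fun y ↦ frameCoord Φ y (σ y) := by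
          ext y
          simp
        simp only [Ψ]
        rw [h1, h3, h2]
        simp
        module
      add := fun {σ σ'} hσ hσ' ↦ by
        have h1 := D.isCovariantDerivativeOnUniv.add hσ hσ'
        have h2 := mvfderiv_add (mdifferentiableAt_frameCoord Φ hg hσ)
          (mdifferentiableAt_frameCoord Φ hg hσ')
        have h3 : (fun y ↦ frameCoord Φ y ((σ + σ') y))
            = (fun y ↦ frameCoord Φ y (σ y)) + fun y ↦ frameCoord Φ y (σ' y) := by
          ext y
          simp
        simp only [Ψ]
        rw [h1, h3, h2]
        simp
        abel }
  obtain ⟨X, rfl⟩ := (leftTranslation x).surjective u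
  obtain ⟨Y, hY⟩ := (leftTranslation x).surjective (Z x)
  have hY' : MDiffAt (T% (mulInvariantVectorField (I := I) (G := G) Y)) x :=
    (contMDiff_mulInvariantVectorField_infty _).contMDiffAt.mdifferentiableAt (by simp)
  have h1 : Ψ Z = Ψ (mulInvariantVectorField Y) := hΨ.pointwise hZ hY' hY.symm
  have hc (y : G) (V : GroupLieAlgebra I G) : frameCoord Φ y (mulInvariantVectorField V y) = Φ V := by
    simp [frameCoord, ← leftTranslation_apply]
  have h2 : Ψ (mulInvariantVectorField Y) = 0 := by
    simp only [Ψ, leftTranslation_apply, hc, mvfderiv_const]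
    rw [hD]
    simp
  rw [h2] at h1
  rwa [← sub_eq_zero, ← sub_sub]

end LeftInvariant

/-! ### Koszul uniqueness and curvature in the frame -/

section LeftInvariant

open VectorField

variable {E : Type*} [NormedAddCommGroup E] [NormedSpace ℝ E]
  {H : Type*} [TopologicalSpace H] {I : ModelWithCorners ℝ E H}
  {G : Type*} [TopologicalSpace G] [ChartedSpace H G] [Group G] [LieGroup I ∞ G]
  [FiniteDimensional ℝ E] {W : Type*} [NormedAddCommGroup W] [NormedSpace ℝ W]
  {g : Metric I G} (Φ : GroupLieAlgebra I G ≃ₗ[ℝ] W)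
  {D : LinearConnection I G} {Γ : W →L[ℝ] W →L[ℝ] W}

theorem frameCoord_mulInvariantVectorField (x : G) (X : GroupLieAlgebra I G) :
    frameCoord Φ x (mulInvariantVectorField X x) = Φ X := by
  simp [frameCoord, ← leftTranslation_apply]

theorem mdifferentiableAt_mulInvariantVectorField_infty (X : GroupLieAlgebra I G) (x : G) :
    MDiffAt (T% (mulInvariantVectorField (I := I) (G := G) X)) x :=
  (contMDiff_mulInvariantVectorField_infty _).contMDiffAt.mdifferentiableAt (by simp)

variable [CompleteSpace E]

/-- Koszul: the torsion-free connection with `∇ g = -2 θ ⊗ g` is determined by its algebraic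
expression on the Lie algebra. -/
theorem isFrameConnection_of_koszul (hg : IsLeftInvariantMetric g) {θ : OneForm I G}
    (hθ : IsLeftInvariantForm θ) (hDθ : IsLeeForm D g θ) (hD : D.torsion = 0)
    (hT : ∀ X Y, Γ (Φ X) (Φ Y) - Γ (Φ Y) (Φ X) = Φ ⁅X, Y⁆)
    (hM : ∀ X Y Z, lieInner g (Φ.symm (Γ (Φ X) (Φ Y))) Z + lieInner g Y (Φ.symm (Γ (Φ X) (Φ Z)))
      = 2 * θ 1 X * lieInner g Y Z) :
    IsFrameConnection D Φ Γ := by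
  intro x X Y
  let δ (X Y : GroupLieAlgebra I G) : GroupLieAlgebra I G :=
    (leftTranslation x).symm (D (mulInvariantVectorField Y) x (mulInvariantVectorField X x))
  have hδ (X Y : GroupLieAlgebra I G) : D (mulInvariantVectorField Y) x
      (mulInvariantVectorField X x) = mulInvariantVectorField (δ X Y) x := by
    rw [← leftTranslation_apply x (δ X Y), LinearEquiv.apply_symm_apply]
  have hT' (X Y : GroupLieAlgebra I G) : δ X Y - δ Y X = ⁅X, Y⁆ := by
    have h := (CovariantDerivative.torsion_eq_zero_iff D).1 hD
      (mdifferentiableAt_mulInvariantVectorField_infty X x)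
      (mdifferentiableAt_mulInvariantVectorField_infty Y x)
    rw [hδ, hδ, ← mulInvariantVector_mlieBracket, ← GroupLieAlgebra.bracket_def] at h
    apply (leftTranslation x).injective
    rw [map_sub]
    exact h
  have hM' (X Y Z : GroupLieAlgebra I G) : lieInner g (δ X Y) Z + lieInner g Y (δ X Z)
      = 2 * θ 1 X * lieInner g Y Z := by
    have h := hDθ _ _ x (mdifferentiableAt_mulInvariantVectorField_infty Y x)
      (mdifferentiableAt_mulInvariantVectorField_infty Z x) (mulInvariantVectorField X x)
    simp only [covDerivMetric, lieInner_eq hg, mvfderiv_const, hδ,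
      hθ.apply_mulInvariantVectorField] at h
    simp only [zero_apply] at h
    linarith
  let Δ (X Y : GroupLieAlgebra I G) : GroupLieAlgebra I G := δ X Y - Φ.symm (Γ (Φ X) (Φ Y))
  have hB (X Y Z : GroupLieAlgebra I G) : lieInner g (Δ X Y) Z
      = lieInner g (δ X Y) Z - lieInner g (Φ.symm (Γ (Φ X) (Φ Y))) Z := by
    simp [lieInner, Δ]
  have hsymm (X Y : GroupLieAlgebra I G) : lieInner g X Y = lieInner g Y X := g.symm 1 X Y
  have hΔs (X Y : GroupLieAlgebra I G) : Δ X Y = Δ Y X := by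
    have h := hT' X Y
    rw [← Φ.symm_apply_apply ⁅X, Y⁆, ← hT, map_sub] at h
    simp only [Δ]
    rw [← sub_eq_zero] at h ⊢
    rw [← h]
    abel
  have hΔk (X Y Z : GroupLieAlgebra I G) : lieInner g (Δ X Y) Z = - lieInner g (Δ X Z) Y := by
    have h1 := hM X Y Z
    have h2 := hM' X Y Z
    rw [hsymm Y] at h1 h2
    rw [hB, hB]
    linarith
  -- A trilinear form symmetric in its first two slots and skew in its last two vanishes: permuting
  -- the arguments around returns it with the opposite sign.
  have h0 (Z : GroupLieAlgebra I G) : lieInner g (Δ X Y) Z = 0 := by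
    have h1 := hΔk X Y Z
    have h2 := hΔk Z X Y
    have h3 := hΔk Y Z X
    rw [hΔs Z X] at h2
    rw [hΔs Z Y] at h2
    rw [hΔs Y X] at h3
    linarith
  have h1 : Δ X Y = 0 := by
    by_contra h
    exact (g.pos 1 _ h).ne' (h0 _)
  change Φ (δ X Y) = _
  rw [sub_eq_zero.1 h1, LinearEquiv.apply_symm_apply]

variable [I.Boundaryless]

/-- Inserting d + Γ twice creates second derivatives of the coordinates of Z and first derivatives
of those of X and Y. All of them cancel against the [X, Y] term, whose coordinates come from
torsion-freeness. Arbitrary fields are needed because `curvature` uses extensions that need not be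
left-invariant. -/
theorem IsFrameConnection.frameCoord_curvatureField (hg : IsLeftInvariantMetric g)
    (hD : IsFrameConnection D Φ Γ) (hT : D.torsion = 0) {X Y Z : Π y : G, TangentSpace I y}
    {x : G} (hX : CMDiffAt 2 (T% X) x) (hY : CMDiffAt 2 (T% Y) x) (hZ : CMDiffAt 2 (T% Z) x) :
    frameCoord Φ x (curvatureField D X Y Z x)
      = Γ (Γ (frameCoord Φ x (X x)) (frameCoord Φ x (Y x))
          - Γ (frameCoord Φ x (Y x)) (frameCoord Φ x (X x))) (frameCoord Φ x (Z x))
        - Γ (frameCoord Φ x (X x)) (Γ (frameCoord Φ x (Y x)) (frameCoord Φ x (Z x)))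
        + Γ (frameCoord Φ x (Y x)) (Γ (frameCoord Φ x (X x)) (frameCoord Φ x (Z x))) := by
  have : IsManifold I 2 G := .of_le (n := ∞) ENat.LEInfty.out
  have hd {V : Π y : G, TangentSpace I y} (hV : CMDiffAt 2 (T% V) x) : MDiffAt (T% V) x :=
    hV.mdifferentiableAt (by simp)
  let F (V : Π y : G, TangentSpace I y) (y : G) : W := frameCoord Φ y (V y)
  have hFZ : ContMDiffAt I 𝓘(ℝ, W) 2 (F Z) x :=
    contMDiffAt_frameCoord Φ hg ENat.LEInfty.out hZ
  have hev (V : Π y : G, TangentSpace I y) : ∀ᶠ y in nhds x,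
      F (fun y ↦ D Z y (V y)) y = mvfderiv I (F Z) y (V y) + Γ (F V y) (F Z y) := by
    have : IsManifold I.tangent 2 (TangentBundle I G) := inferInstance
    filter_upwards [(contMDiffAt_iff_contMDiffAt_nhds (by simp)).1 hZ] with y hy
    exact hD.apply Φ hg (hy.mdifferentiableAt (by simp)) (V y)
  have hdF {V : Π y : G, TangentSpace I y} (hV : CMDiffAt 2 (T% V) x) : MDiffAt (F V) x :=
    mdifferentiableAt_frameCoord Φ hg (hd hV)
  have hdFZ {V : Π y : G, TangentSpace I y} (hV : CMDiffAt 2 (T% V) x) :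
      MDiffAt (fun y ↦ mvfderiv I (F Z) y (V y)) x := mdifferentiableAt_mvfderiv_apply hFZ (hd hV)
  have hdΓ {V : Π y : G, TangentSpace I y} (hV : CMDiffAt 2 (T% V) x) :
      MDiffAt (fun y ↦ Γ (F V y) (F Z y)) x :=
    DifferentiableAt.comp_mdifferentiableAt (f := fun y ↦ (F V y, F Z y))
      (Γ.isBoundedBilinearMap.differentiableAt (F V x, F Z x)) ((hdF hV).prodMk_space (hdF hZ))
  have second {V : Π y : G, TangentSpace I y} (hV : CMDiffAt 2 (T% V) x) (s : TangentSpace I x) :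
      frameCoord Φ x (D (fun y ↦ D Z y (V y)) x s)
        = mvfderiv I (fun y ↦ mvfderiv I (F Z) y (V y)) x s
          + (Γ (F V x) (mvfderiv I (F Z) x s) + Γ (mvfderiv I (F V) x s) (F Z x))
          + Γ (frameCoord Φ x s) (mvfderiv I (F Z) x (V x) + Γ (F V x) (F Z x)) := by
    have h1 : MDiffAt (F (fun y ↦ D Z y (V y))) x :=
      ((hdFZ hV).add (hdΓ hV)).congr_of_eventuallyEq (hev V)
    rw [hD.apply Φ hg (mdifferentiableAt_of_frameCoord Φ h1)]
    have h2 : mvfderiv I (F (fun y ↦ D Z y (V y))) x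
        = mvfderiv I (fun y ↦ mvfderiv I (F Z) y (V y) + Γ (F V y) (F Z y)) x :=
      Filter.EventuallyEq.mfderiv_eq (hev V)
    have h3 := mvfderiv_add (hdFZ hV) (hdΓ hV)
    have h4 := (hev V).self_of_nhds
    simp only [F] at h2 h3 h4 ⊢
    rw [h2, h4]
    have h5 := congrArg (fun L ↦ L s) h3
    have h6 := mvfderiv_bilinear Γ (hdF hV) (hdF hZ) s
    simp only [F] at h6
    simp only [add_apply, h6] at h5
    congr 1
  have hbr : frameCoord Φ x (mlieBracket I X Y x)
      = (mvfderiv I (F Y) x (X x) + Γ (F X x) (F Y x))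
        - (mvfderiv I (F X) x (Y x) + Γ (F Y x) (F X x)) := by
    rw [← (CovariantDerivative.torsion_eq_zero_iff D).1 hT (hd hX) (hd hY), map_sub,
      hD.apply Φ hg (hd hX), hD.apply Φ hg (hd hY)]
  have hFbr := mvfderiv_mlieBracket hFZ (hd hX) (hd hY) (hdFZ hX)
    (hdFZ hY)
  rw [curvatureField, map_add, map_sub, hD.apply Φ hg (hd hZ), second hX, second hY, hbr]
  change mvfderiv I (F Z) x _ + _ - _ + _ = _
  rw [hFbr]
  simp only [F, map_add, map_sub, add_apply, sub_apply]
  abel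

theorem IsFrameConnection.frameCoord_curvature (hg : IsLeftInvariantMetric g)
    (hD : IsFrameConnection D Φ Γ) (hT : D.torsion = 0) (x : G) (u v w : TangentSpace I x) :
    frameCoord Φ x (curvature D x u v w)
      = Γ (Γ (frameCoord Φ x u) (frameCoord Φ x v) - Γ (frameCoord Φ x v) (frameCoord Φ x u))
          (frameCoord Φ x w)
        - Γ (frameCoord Φ x u) (Γ (frameCoord Φ x v) (frameCoord Φ x w))
        + Γ (frameCoord Φ x v) (Γ (frameCoord Φ x u) (frameCoord Φ x w)) := by
  have hext (u : TangentSpace I x) : CMDiffAt 2 (T% (FiberBundle.extend E u)) x :=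
    FiberBundle.contMDiffAt_extend I E u
  have h := hD.frameCoord_curvatureField Φ hg hT (hext u) (hext v) (hext w)
  simp only [FiberBundle.extend_apply_self] at h
  exact h

end LeftInvariant

/-- The derivative of the determinant at the identity is the trace. -/
theorem hasFDerivAt_det_one {n : Type*} [Fintype n] [DecidableEq n] :
    ∃ L : (n → n → ℝ) →L[ℝ] ℝ, (∀ B : n → n → ℝ, L B = ∑ i, B i i) ∧
      HasFDerivAt (fun A : n → n → ℝ ↦ (Matrix.of A).det) L (fun i j ↦ (1 : Matrix n n ℝ) i j) := by
  have hd : Differentiable ℝ (fun A : n → n → ℝ ↦ (Matrix.of A).det) := by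
    simp only [Matrix.det_apply, Matrix.of_apply]
    fun_prop
  refine ⟨_, fun B ↦ ?_, (hd _).hasFDerivAt⟩
  have h1 : HasDerivAt (fun r : ℝ ↦ (fun i j ↦ (1 : Matrix n n ℝ) i j) + r • B) B 0 := by
    simpa using ((hasDerivAt_id (0 : ℝ)).smul_const B).const_add (fun i j ↦ (1 : Matrix n n ℝ) i j)
  have h2 : HasFDerivAt (fun A : n → n → ℝ ↦ (Matrix.of A).det) _
    ((fun i j ↦ (1 : Matrix n n ℝ) i j) + (0 : ℝ) • B) := (hd _).hasFDerivAt
  have h3 := h2.comp_hasDerivAt (0 : ℝ) h1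
  simp only [zero_smul, add_zero] at h3
  -- The determinant is 1 + r tr B plus r² times a polynomial in r.
  have h4 : HasDerivAt (fun r : ℝ ↦ (1 + r • Matrix.of B).det) (∑ i, B i i) 0 := by
    have h5 : (fun r : ℝ ↦ (1 + r • Matrix.of B).det) = fun r ↦ 1 + (Matrix.of B).trace * r
        + (Polynomial.divX (Polynomial.divX (1 + (Polynomial.X : Polynomial ℝ) •
          (Matrix.of B).map Polynomial.C).det)).eval r * r ^ 2 :=
      funext fun r ↦ Matrix.det_one_add_smul r _
    rw [h5]
    have h6 := (((hasDerivAt_id (0 : ℝ)).const_mul (Matrix.of B).trace).const_add 1).add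
      ((Polynomial.hasDerivAt (Polynomial.divX (Polynomial.divX (1 + (Polynomial.X : Polynomial ℝ) •
          (Matrix.of B).map Polynomial.C).det)) 0).mul ((hasDerivAt_id (0 : ℝ)).pow 2))
    convert! h6 using 1
    simp [Matrix.trace]
  exact h3.unique h4

/-! ### The adjoint representation and the modular function -/

section RightInvariant

open VectorField

variable {E : Type*} [NormedAddCommGroup E] [NormedSpace ℝ E]
  {H : Type*} [TopologicalSpace H] {I : ModelWithCorners ℝ E H}
  {G : Type*} [TopologicalSpace G] [ChartedSpace H G] [Group G] [LieGroup I ∞ G]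

/-- The right-invariant vector field with a given value at `1`. -/
def rightInvariantField (v : GroupLieAlgebra I G) (x : G) : TangentSpace I x :=
  mfderiv I I (fun y ↦ y * x) (1 : G) v

theorem rightInvariantField_one (v : GroupLieAlgebra I G) :
    rightInvariantField v (1 : G) = v := by
  have h : (fun y : G ↦ y * (1 : G)) = id := by ext; simp
  rw [rightInvariantField, h, mfderiv_id]
  rfl

theorem contMDiff_rightInvariantField (v : GroupLieAlgebra I G) :
    CMDiff ∞ (fun x : G ↦ (rightInvariantField v x : TangentBundle I G)) := by
  let fg : G → TangentBundle I G := fun g ↦ Bundle.TotalSpace.mk' E g 0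
  have sfg : CMDiff ∞ fg := Bundle.contMDiff_zeroSection _ _
  let fv : G → TangentBundle I G := fun _ ↦ Bundle.TotalSpace.mk' E 1 v
  have sfv : CMDiff ∞ fv := contMDiff_const
  let F₁ : G → (TangentBundle I G × TangentBundle I G) := fun g ↦ (fv g, fg g)
  have S₁ : CMDiff ∞ F₁ := sfv.prodMk sfg
  let F₂ : (TangentBundle I G × TangentBundle I G) → TangentBundle (I.prod I) (G × G) :=
    (equivTangentBundleProd I G I G).symm
  have S₂ : CMDiff ∞ F₂ := contMDiff_equivTangentBundleProd_symm
  let F₃ : TangentBundle (I.prod I) (G × G) → TangentBundle I G :=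
    tangentMap% (fun (p : G × G) ↦ p.1 * p.2)
  have S₃ : CMDiff ∞ F₃ := (contMDiff_mul I ∞).contMDiff_tangentMap (m := ∞) (by simp)
  let S := (S₃.comp S₂).comp S₁
  convert! S with g
  · simp [F₁, F₂, F₃, fg, fv]
  · simp only [Function.comp_apply, tangentMap, F₃, F₂, F₁, fg, fv]
    rw [mfderiv_prod_eq_add_apply ((contMDiff_mul I ∞).mdifferentiableAt (by simp))]
    simp +instances only [rightInvariantField]
    exact ((congrArg (mfderiv I I (fun z ↦ z * g) (1 : G) v + ·)
      (map_zero (mfderiv I I (fun z : G ↦ 1 * z) g))).trans (add_zero _)).symm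

theorem mdifferentiableAt_mul_left' (x y : G) : MDiffAt (fun z ↦ x * z) y :=
  (contMDiff_mul_left (n := ∞)).contMDiffAt.mdifferentiableAt (by simp)

theorem mdifferentiableAt_mul_right' (x y : G) : MDiffAt (fun z ↦ z * x) y :=
  (contMDiff_mul_right (n := ∞)).contMDiffAt.mdifferentiableAt (by simp)

variable [FiniteDimensional ℝ E]

/-- The value at `x` of the right-invariant field, translated back to the Lie algebra: this is
`Ad (x⁻¹)`. -/
def adInv (x : G) : GroupLieAlgebra I G →ₗ[ℝ] GroupLieAlgebra I G :=
  (leftTranslation x).symm.toLinearMap ∘ₗ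
    (mfderiv I I (fun y ↦ y * x) (1 : G) : E →L[ℝ] E).toLinearMap

theorem leftTranslation_adInv (x : G) (v : GroupLieAlgebra I G) :
    mulInvariantVectorField (adInv x v) x = rightInvariantField v x :=
  (leftTranslation x).apply_symm_apply _

theorem adInv_one : adInv (1 : G) = (LinearMap.id : GroupLieAlgebra I G →ₗ[ℝ] _) := by
  ext v
  have h := leftTranslation_adInv (1 : G) v
  rwa [mulInvariantVectorField_one, rightInvariantField_one] at h

theorem adInv_mul (x y : G) :
    adInv (x * y) = (adInv y ∘ₗ adInv x : GroupLieAlgebra I G →ₗ[ℝ] _) := by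
  ext v
  apply mulInvariantVectorField_injective (x * y)
  simp only
  rw [leftTranslation_adInv]
  have hA := mfderiv_comp_apply_of_eq (1 : G) (I := I) (I' := I) (I'' := I)
    (mdifferentiableAt_mul_right' y x) (mdifferentiableAt_mul_right' x 1) (one_mul x) v
  have hB := mfderiv_comp_apply_of_eq (1 : G) (I := I) (I' := I) (I'' := I)
    (mdifferentiableAt_mul_right' y x) (mdifferentiableAt_mul_left' x 1) (mul_one x) (adInv x v)
  have hC := mfderiv_comp_apply_of_eq (1 : G) (I := I) (I' := I) (I'' := I)
    (mdifferentiableAt_mul_left' x y) (mdifferentiableAt_mul_right' y 1) (one_mul y) (adInv x v)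
  have hD := mfderiv_comp_apply_of_eq (1 : G) (I := I) (I' := I) (I'' := I)
    (mdifferentiableAt_mul_left' x y) (mdifferentiableAt_mul_left' y 1) (mul_one y)
      (adInv y (adInv x v))
  have e1 : (fun z : G ↦ z * y) ∘ (fun z ↦ z * x) = fun z ↦ z * (x * y) := by
    ext; simp [mul_assoc]
  have e2 : (fun z : G ↦ x * z) ∘ (fun z ↦ z * y) = (fun z : G ↦ z * y) ∘ (fun z ↦ x * z) := by
    ext; simp [mul_assoc]
  have e3 : (fun z : G ↦ x * z) ∘ (fun z ↦ y * z) = fun z ↦ (x * y) * z := by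
    ext; simp [mul_assoc]
  have h1 : rightInvariantField v (x * y) = mfderiv I I (fun z ↦ z * y) x
      (rightInvariantField v x) := by rw [e1] at hA; exact hA
  have h2 : mfderiv I I (fun z ↦ z * y) x (mulInvariantVectorField (adInv x v) x)
      = mfderiv I I (fun z ↦ x * z) y (rightInvariantField (adInv x v) y) := by
    rw [e2] at hC; exact hB.symm.trans hC
  rw [e3] at hD
  rw [h1, ← leftTranslation_adInv, h2, ← leftTranslation_adInv]
  exact hD.symm

variable [CompleteSpace E] [I.Boundaryless]

/-- Left and right translations commute. In a chart, with n the multiplication, the two fields are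
partial derivatives of n in its second and first slots, so the two halves of the bracket at 1 are
one mixed second derivative of n taken in both orders. -/
theorem mlieBracket_mulInvariant_rightInvariant (X Y : GroupLieAlgebra I G) :
    mlieBracket I (mulInvariantVectorField X) (rightInvariantField Y) (1 : G) = 0 := by
  set φ := extChartAt I (1 : G) with hφ
  have hy : φ 1 ∈ φ.target := mem_extChartAt_target (I := I) (1 : G)
  have hinv : φ.symm (φ 1) = 1 := by simp [hφ]
  have hψ {p : E} (hp : p ∈ φ.target) : ContMDiffAt 𝓘(ℝ, E) I ∞ φ.symm p :=
    contMDiffAt_extChartAt_symm' hp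
  have hψd : MDiffAt φ.symm (φ 1) := (hψ hy).mdifferentiableAt (by simp)
  let n : E × E → E := fun pq ↦ φ (φ.symm pq.1 * φ.symm pq.2)
  have hφs : ContMDiffAt I 𝓘(ℝ, E) ∞ φ (1 : G) := contMDiffAt_extChartAt
  have hφd {z : G} (hz : z ∈ φ.source) : MDiffAt φ z :=
    (contMDiffAt_extChartAt' (n := ∞) (by simpa [hφ] using hz)).mdifferentiableAt (by simp)
  have hn : ContDiffAt ℝ ∞ n (φ 1, φ 1) := by
    refine contMDiffAt_iff_contDiffAt.1 (ContMDiffAt.comp_of_eq (y := (1 : G)) hφs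
      (ContMDiffAt.mul (I := I) (n := ∞) ?_ ?_) (by simp [hinv]))
    · exact ContMDiffAt.comp_of_eq (hψ hy) contDiffAt_fst.contMDiffAt rfl
    · exact ContMDiffAt.comp_of_eq (hψ hy) contDiffAt_snd.contMDiffAt rfl
  have hnd : ∀ᶠ q in nhds (φ 1, φ 1), DifferentiableAt ℝ n q :=
    ((hn.of_le (m := 1) ENat.LEInfty.out).eventually (by simp)).mono
      fun q hq ↦ hq.differentiableAt (by simp)
  let hat (V : Π x : G, TangentSpace I x) : E := mpullback 𝓘(ℝ, E) I φ.symm V (φ 1)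
  have hhat (V : Π x : G, TangentSpace I x) :
      mfderiv 𝓘(ℝ, E) I φ.symm (φ 1) (hat V) = (V 1 : E) := by
    have h1 : mfderiv 𝓘(ℝ, E) I φ.symm (φ 1) (hat V) = V (φ.symm (φ 1)) :=
      (isInvertible_mfderiv_extChartAt_symm hy).self_apply_inverse _
    have h2 : ∀ y : G, y = 1 → (V y : E) = V 1 := by
      rintro _ rfl
      rfl
    exact h1.trans (h2 _ hinv)
  have hL : ∀ᶠ p in nhds (φ 1), mvfderiv I φ (φ.symm p) (mulInvariantVectorField X (φ.symm p))
      = fderiv ℝ n (p, φ 1) (0, hat (mulInvariantVectorField X)) := by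
    have hc : Filter.Tendsto (fun p ↦ (p, φ 1)) (nhds (φ 1)) (nhds (φ 1, φ 1)) :=
      (continuous_id.prodMk continuous_const).tendsto _
    filter_upwards [hc.eventually hnd, (isOpen_extChartAt_target (1 : G)).mem_nhds hy] with p hp hpt
    have h1 := mfderiv_comp_apply_of_eq (φ 1) (I := 𝓘(ℝ, E)) (I' := I) (I'' := I)
      (mdifferentiableAt_mul_left' (φ.symm p) 1) hψd hinv (hat (mulInvariantVectorField X))
    have h2 := mfderiv_comp_apply_of_eq (φ 1) (I := 𝓘(ℝ, E)) (I' := I) (I'' := 𝓘(ℝ, E))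
      (hφd (φ.map_target hpt)) (MDifferentiableAt.comp_of_eq (φ 1) (mdifferentiableAt_mul_left' (φ.symm p) 1) hψd hinv)
      (show φ.symm p * φ.symm (φ 1) = φ.symm p by rw [hinv, mul_one]) (hat (mulInvariantVectorField X))
    rw [hhat, mulInvariantVectorField_one] at h1
    rw [h1, mfderiv_eq_fderiv] at h2
    have h3 := fderiv_comp (𝕜 := ℝ) (φ 1) (g := n) (f := fun q ↦ (p, q)) hp
      ((differentiableAt_const p).prodMk differentiableAt_id)
    have h4 := (hasFDerivAt_prodMk_right (𝕜 := ℝ) p (φ 1)).fderiv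
    rw [h4] at h3
    have h5 := congrArg (fun L ↦ L (hat (mulInvariantVectorField X))) h3
    exact h2.symm.trans h5
  have hR : ∀ᶠ p in nhds (φ 1), mvfderiv I φ (φ.symm p) (rightInvariantField Y (φ.symm p))
      = fderiv ℝ n (φ 1, p) (hat (rightInvariantField Y), 0) := by
    have hc : Filter.Tendsto (fun p ↦ (φ 1, p)) (nhds (φ 1)) (nhds (φ 1, φ 1)) :=
      (continuous_const.prodMk continuous_id).tendsto _
    filter_upwards [hc.eventually hnd, (isOpen_extChartAt_target (1 : G)).mem_nhds hy] with p hp hpt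
    have h1 := mfderiv_comp_apply_of_eq (φ 1) (I := 𝓘(ℝ, E)) (I' := I) (I'' := I)
      (mdifferentiableAt_mul_right' (φ.symm p) 1) hψd hinv (hat (rightInvariantField Y))
    have h2 := mfderiv_comp_apply_of_eq (φ 1) (I := 𝓘(ℝ, E)) (I' := I) (I'' := 𝓘(ℝ, E))
      (hφd (φ.map_target hpt)) (MDifferentiableAt.comp_of_eq (φ 1) (mdifferentiableAt_mul_right' (φ.symm p) 1) hψd hinv)
      (show φ.symm (φ 1) * φ.symm p = φ.symm p by rw [hinv, one_mul]) (hat (rightInvariantField Y))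
    rw [hhat, rightInvariantField_one] at h1
    rw [h1, mfderiv_eq_fderiv] at h2
    have h3 := fderiv_comp (𝕜 := ℝ) (φ 1) (g := n) (f := fun q ↦ (q, p)) hp
      (differentiableAt_id.prodMk (differentiableAt_const p))
    have h4 := (hasFDerivAt_prodMk_left (𝕜 := ℝ) (φ 1) p).fderiv
    rw [h4] at h3
    have h5 := congrArg (fun L ↦ L (hat (rightInvariantField Y))) h3
    exact h2.symm.trans h5
  have hLd : MDiffAt (T% (mulInvariantVectorField (I := I) (G := G) X)) 1 :=
    mdifferentiableAt_mulInvariantVectorField_infty X 1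
  have hRd : MDiffAt (T% (rightInvariantField (I := I) (G := G) Y)) 1 :=
    (contMDiff_rightInvariantField Y).contMDiffAt.mdifferentiableAt (by simp)
  have hφ2 : ContMDiffAt I 𝓘(ℝ, E) 2 φ (1 : G) := contMDiffAt_extChartAt
  have hchart (h : G → E) (hh : MDiffAt h 1) (V : Π x : G, TangentSpace I x) :
      mvfderiv I h 1 (V 1) = fderiv ℝ (h ∘ φ.symm) (φ 1) (hat V) := by
    have := fderiv_comp_extChartAt_symm_mpullback hy V (f := h) (by rwa [hinv])
    rw [hinv] at this
    exact this.symm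
  have hLf := mdifferentiableAt_mvfderiv_apply hφ2 hLd
  have hRf := mdifferentiableAt_mvfderiv_apply hφ2 hRd
  have hbr := mvfderiv_mlieBracket hφ2 hLd hRd hLf hRf
  have hn2 : DifferentiableAt ℝ (fderiv ℝ n) (φ 1, φ 1) :=
    ((hn.of_le (m := 2) ENat.LEInfty.out).fderiv_right (m := 1) (by norm_num)).differentiableAt
      (by simp)
  have hsym := (hn.of_le (m := 2) ENat.LEInfty.out).isSymmSndFDerivAt (by simp)
  rw [hchart _ hLf, hchart _ hRf] at hbr
  have e1 : fderiv ℝ ((fun y ↦ mvfderiv I φ y (rightInvariantField Y y)) ∘ φ.symm) (φ 1)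
      (hat (mulInvariantVectorField X)) = fderiv ℝ (fderiv ℝ n) (φ 1, φ 1)
        (0, hat (mulInvariantVectorField X)) (hat (rightInvariantField Y), 0) := by
    rw [Filter.EventuallyEq.fderiv_eq (show ((fun y ↦ mvfderiv I φ y (rightInvariantField Y y)) ∘ φ.symm)
      =ᶠ[nhds (φ 1)] fun p ↦ fderiv ℝ n (φ 1, p) (hat (rightInvariantField Y), 0) from hR)]
    have h1 : HasFDerivAt (fun p ↦ fderiv ℝ n (φ 1, p))
        ((fderiv ℝ (fderiv ℝ n) (φ 1, φ 1)).comp (ContinuousLinearMap.inr ℝ E E)) (φ 1) :=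
      hn2.hasFDerivAt.comp (φ 1) (hasFDerivAt_prodMk_right (𝕜 := ℝ) (φ 1) (φ 1))
    rw [(h1.clm_apply (hasFDerivAt_const (hat (rightInvariantField Y), (0 : E)) (φ 1))).fderiv]
    simp
  have e2 : fderiv ℝ ((fun y ↦ mvfderiv I φ y (mulInvariantVectorField X y)) ∘ φ.symm) (φ 1)
      (hat (rightInvariantField Y)) = fderiv ℝ (fderiv ℝ n) (φ 1, φ 1)
        (hat (rightInvariantField Y), 0) (0, hat (mulInvariantVectorField X)) := by
    rw [Filter.EventuallyEq.fderiv_eq (show ((fun y ↦ mvfderiv I φ y (mulInvariantVectorField X y)) ∘ φ.symm)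
      =ᶠ[nhds (φ 1)] fun p ↦ fderiv ℝ n (p, φ 1) (0, hat (mulInvariantVectorField X)) from hL)]
    have h1 : HasFDerivAt (fun p ↦ fderiv ℝ n (p, φ 1))
        ((fderiv ℝ (fderiv ℝ n) (φ 1, φ 1)).comp (ContinuousLinearMap.inl ℝ E E)) (φ 1) :=
      HasFDerivAt.comp (f := fun p ↦ (p, φ 1)) (φ 1) hn2.hasFDerivAt
        (hasFDerivAt_prodMk_left (𝕜 := ℝ) (φ 1) (φ 1))
    rw [(h1.clm_apply (hasFDerivAt_const ((0 : E), hat (mulInvariantVectorField X)) (φ 1))).fderiv]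
    simp
  rw [e1, e2, hsym, sub_self] at hbr
  have hinj : (mfderiv I 𝓘(ℝ, E) φ (1 : G)).IsInvertible :=
    isInvertible_mfderiv_extChartAt (mem_extChartAt_source (1 : G))
  exact hinj.injective (hbr.trans (map_zero _).symm)

variable {W : Type*} [NormedAddCommGroup W] [NormedSpace ℝ W]
  {g : Metric I G} (Φ : GroupLieAlgebra I G ≃ₗ[ℝ] W)
  {D : LinearConnection I G} {Γ : W →L[ℝ] W →L[ℝ] W}

/-- The right-invariant field of Y has left-frame coordinates `Φ (adInv x Y)`. Torsion-freeness for
this field and left-invariant X, whose bracket vanishes at 1, is compared with torsion-freeness for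
left-invariant X and Y; the Γ-terms drop out. -/
theorem IsFrameConnection.mvfderiv_adInv (hg : IsLeftInvariantMetric g)
    (hD : IsFrameConnection D Φ Γ) (hT : D.torsion = 0) (X Y : GroupLieAlgebra I G) :
    mvfderiv I (fun x : G ↦ Φ (adInv x Y)) 1 X = -Φ ⁅X, Y⁆ := by
  have hL (V : GroupLieAlgebra I G) : MDiffAt (T% (mulInvariantVectorField (I := I) (G := G) V)) 1 :=
    mdifferentiableAt_mulInvariantVectorField_infty V 1
  have hRd : MDiffAt (T% (rightInvariantField (I := I) (G := G) Y)) 1 :=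
    (contMDiff_rightInvariantField Y).contMDiffAt.mdifferentiableAt (by simp)
  have h1 := congrArg (frameCoord Φ 1)
    ((CovariantDerivative.torsion_eq_zero_iff D).1 hT (hL X) hRd)
  have h2 := congrArg (frameCoord Φ 1)
    ((CovariantDerivative.torsion_eq_zero_iff D).1 hT (hL X) (hL Y))
  rw [map_sub, hD.apply Φ hg (hL X), hD.apply Φ hg hRd, mlieBracket_mulInvariant_rightInvariant,
    map_zero] at h1
  rw [map_sub, hD.apply Φ hg (hL X), hD.apply Φ hg (hL Y), ← GroupLieAlgebra.bracket_def,
    ← mulInvariantVectorField_one ⁅X, Y⁆] at h2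
  simp only [frameCoord_mulInvariantVectorField, mvfderiv_const, zero_apply, zero_add,
    rightInvariantField_one, mulInvariantVectorField_one] at h1 h2
  have h3 (V : GroupLieAlgebra I G) : frameCoord Φ (1 : G) V = Φ V := by
    rw [← frameCoord_mulInvariantVectorField Φ 1 V, mulInvariantVectorField_one]
  have h4 : (fun x : G ↦ Φ (adInv x Y)) = fun x ↦ frameCoord Φ x (rightInvariantField Y x) := by
    ext x
    rw [← leftTranslation_adInv, frameCoord_mulInvariantVectorField]
  rw [add_sub_assoc, h2, h3 ⁅X, Y⁆] at h1
  rw [h4]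
  exact eq_neg_of_add_eq_zero_left h1

theorem contMDiff_adInv (hg : IsLeftInvariantMetric g) (Y : GroupLieAlgebra I G) :
    ContMDiff I 𝓘(ℝ, W) ∞ (fun x : G ↦ Φ (adInv x Y)) := by
  have h4 : (fun x : G ↦ Φ (adInv x Y)) = fun x ↦ frameCoord Φ x (rightInvariantField Y x) := by
    ext x
    rw [← leftTranslation_adInv, frameCoord_mulInvariantVectorField]
  rw [h4]
  exact fun x ↦ contMDiffAt_frameCoord Φ hg le_rfl (contMDiff_rightInvariantField Y).contMDiffAt

theorem mvfderiv_clm_comp {W' : Type*} [NormedAddCommGroup W'] [NormedSpace ℝ W'] (ℓ : W →L[ℝ] W')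
    {h : G → W} {x : G} (hh : MDiffAt h x) (u : TangentSpace I x) :
    mvfderiv I (fun y ↦ ℓ (h y)) x u = ℓ (mvfderiv I h x u) := by
  have h1 := mfderiv_comp_apply x (f := h) ℓ.differentiableAt.mdifferentiableAt hh u
  rw [mfderiv_eq_fderiv, ℓ.fderiv] at h1
  exact h1

theorem det_adInv_mul (x y : G) : LinearMap.det (adInv (I := I) (x * y))
    = LinearMap.det (adInv (I := I) x) * LinearMap.det (adInv (I := I) y) := by
  rw [adInv_mul, LinearMap.det_comp, mul_comm]

theorem det_adInv_ne_zero (x : G) :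
    LinearMap.det (adInv (I := I) x) ≠ 0 := by
  have h := det_adInv_mul (I := I) x x⁻¹
  rw [mul_inv_cancel, adInv_one, LinearMap.det_id] at h
  exact left_ne_zero_of_mul (h ▸ one_ne_zero)

/-- A left-invariant form proportional to `X ↦ tr ad_X` is exact: a primitive is the logarithm
of the modular function. -/
theorem IsFrameConnection.exists_primitive (hg : IsLeftInvariantMetric g)
    (hD : IsFrameConnection D Φ Γ) (hT : D.torsion = 0) {θ : OneForm I G}
    (hθ : IsLeftInvariantForm θ) {c : ℝ} (hc : ∀ X : GroupLieAlgebra I G, θ 1 X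
      = c * LinearMap.trace ℝ _ (LieAlgebra.ad ℝ (GroupLieAlgebra I G) X)) :
    ∃ f : C^∞⟮I, G; 𝓘(ℝ, ℝ), ℝ⟯, mvfderiv I f = θ := by
  have hfd : FiniteDimensional ℝ (GroupLieAlgebra I G) := inferInstanceAs (FiniteDimensional ℝ E)
  have : FiniteDimensional ℝ W := Φ.finiteDimensional
  let b := Module.finBasis ℝ W
  let β := b.map Φ.symm
  let ℓ (i) : W →L[ℝ] ℝ := (b.coord i).toContinuousLinearMap
  have hβ (i) (X : GroupLieAlgebra I G) : β.repr X i = ℓ i (Φ X) := rfl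
  let P (x : G) (i j : Fin (Module.finrank ℝ W)) : ℝ := ℓ i (Φ (adInv x (β j)))
  have hP (x : G) : (Matrix.of (P x)).det = LinearMap.det (adInv (I := I) x) := by
    rw [← LinearMap.det_toMatrix β]
    congr 1
    ext i j
    rw [LinearMap.toMatrix_apply]
    rfl
  have hPs : ContMDiff I 𝓘(ℝ, Fin (Module.finrank ℝ W) → Fin (Module.finrank ℝ W) → ℝ) ∞ P :=
    contMDiff_pi_space.2 fun i ↦ contMDiff_pi_space.2 fun j ↦
      (ℓ i).contDiff.contMDiff.comp (contMDiff_adInv Φ hg (β j))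
  -- `Real.log` is log |·|, so the sign of the determinant is harmless. As `adInv x` is Ad (x⁻¹),
  -- the primitive is c log |det Ad x|.
  let F (A : Fin (Module.finrank ℝ W) → Fin (Module.finrank ℝ W) → ℝ) : ℝ :=
    -c * Real.log (Matrix.of A).det
  have hF {A} (hA : (Matrix.of A).det ≠ 0) : ContDiffAt ℝ ∞ F A := by
    have h1 : ContDiff ℝ ∞ (fun A : Fin (Module.finrank ℝ W) → Fin (Module.finrank ℝ W) → ℝ ↦
        (Matrix.of A).det) := by
      simp only [Matrix.det_apply, Matrix.of_apply]
      fun_prop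
    exact contDiffAt_const.mul (h1.contDiffAt.log hA)
  have hP0 (x : G) : (Matrix.of (P x)).det ≠ 0 := hP x ▸ det_adInv_ne_zero x
  let f : C^∞⟮I, G; 𝓘(ℝ, ℝ), ℝ⟯ :=
    ⟨F ∘ P, fun x ↦ ContMDiffAt.comp x (hF (hP0 x)).contMDiffAt (hPs x)⟩
  have hfd (x : G) : MDiffAt f x := f.contMDiff.contMDiffAt.mdifferentiableAt (by simp)
  have hmul (x y : G) : f (x * y) = f x + f y := by
    change -c * Real.log _ = -c * Real.log _ + -c * Real.log _
    rw [hP, hP, hP, det_adInv_mul, Real.log_mul (det_adInv_ne_zero x) (det_adInv_ne_zero y)]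
    ring
  have hone (X : GroupLieAlgebra I G) : mvfderiv I f 1 X = θ 1 X := by
    obtain ⟨L, hL, hdet⟩ := hasFDerivAt_det_one (n := Fin (Module.finrank ℝ W))
    have hP1 : P 1 = fun i j ↦ (1 : Matrix _ _ ℝ) i j := by
      ext i j
      change β.repr (adInv 1 (β j)) i = _
      rw [adInv_one, LinearMap.id_apply, Module.Basis.repr_self, Matrix.one_apply,
        Finsupp.single_apply]
      simp only [eq_comm]
    have hF1 : HasFDerivAt F ((-c) • L) (P 1) := by
      rw [hP1]
      have hd1 : (Matrix.of fun i j ↦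
          (1 : Matrix (Fin (Module.finrank ℝ W)) (Fin (Module.finrank ℝ W)) ℝ) i j).det = 1 :=
        Matrix.det_one
      have h6 := (hdet.log (by rw [hd1]; exact one_ne_zero)).const_mul (-c)
      rw [hd1, inv_one, one_smul] at h6
      exact h6
    have h1 := mfderiv_comp_apply (1 : G) (f := P) hF1.differentiableAt.mdifferentiableAt
      ((hPs 1).mdifferentiableAt (by simp)) X
    rw [mfderiv_eq_fderiv, hF1.fderiv] at h1
    have h2 (i j) : mvfderiv I P 1 X i j = -ℓ i (Φ ⁅X, β j⁆) := by
      have h3 := mvfderiv_clm_comp ((ContinuousLinearMap.proj (R := ℝ) (φ := fun _ ↦ ℝ) j).comp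
        (ContinuousLinearMap.proj (R := ℝ) i)) ((hPs 1).mdifferentiableAt (by simp)) X
      have h4 := mvfderiv_clm_comp (ℓ i)
        ((contMDiff_adInv Φ hg (β j)).contMDiffAt.mdifferentiableAt (by simp)) X
      rw [hD.mvfderiv_adInv Φ hg hT, map_neg] at h4
      exact h3.symm.trans h4
    have h5 : mvfderiv I f 1 X = (-c) * L (mvfderiv I P 1 X) := h1
    rw [h5, hL, hc, LinearMap.trace_eq_matrix_trace ℝ β, Matrix.trace]
    simp [h2, LinearMap.toMatrix_apply, hβ]
  -- Additivity f (x z) = f x + f z makes df left-invariant, so agreement with θ at 1 is enough.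
  refine ⟨f, ?_⟩
  ext x u
  obtain ⟨X, rfl⟩ := (leftTranslation x).surjective u
  rw [leftTranslation_apply, hθ.apply_mulInvariantVectorField, ← hone]
  have h1 := mfderiv_comp_apply_of_eq (1 : G) (I := I) (I' := I) (I'' := 𝓘(ℝ, ℝ))
    (hfd x) (mdifferentiableAt_mul_left' x 1) (mul_one x) X
  have h2 : f ∘ (fun z ↦ x * z) = fun z ↦ f x + f z := funext fun z ↦ hmul x z
  rw [h2] at h1
  have h3 := congrArg (fun L ↦ L X)
    (mvfderiv_add (mdifferentiableAt_const (I := I) (x := (1 : G)) (c := f x)) (hfd 1))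
  refine h1.symm.trans (h3.trans ?_)
  simp [mvfderiv_const]

end RightInvariant

/-! ### Conformal change and the Lee form -/

section Conformal

variable {E : Type*} [NormedAddCommGroup E] [NormedSpace ℝ E]
  {H : Type*} [TopologicalSpace H] {I : ModelWithCorners ℝ E H}
  {M : Type*} [TopologicalSpace M] [ChartedSpace H M] [IsManifold I ∞ M]

theorem covDerivMetric_conformalChange (D : LinearConnection I M) (g : Metric I M)
    (f : C^∞⟮I, M; 𝓘(ℝ, ℝ), ℝ⟯) {Y Z : Π x : M, TangentSpace I x} {x : M}
    (hY : MDiffAt (T% Y) x) (hZ : MDiffAt (T% Z) x) (u : TangentSpace I x) :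
    covDerivMetric D (conformalChange g f) Y Z x u = Real.exp (2 * f x) *
      (covDerivMetric D g Y Z x u + 2 * mvfderiv I f x u * g.inner x (Y x) (Z x)) := by
  have hf : MDiffAt f x := f.contMDiff.contMDiffAt.mdifferentiableAt (by simp)
  have h1 : HasFDerivAt (fun r : ℝ ↦ Real.exp (2 * r))
      (ContinuousLinearMap.toSpanSingleton ℝ (2 * Real.exp (2 * f x))) (f x) := by
    have := ((hasDerivAt_id (f x)).const_mul (2 : ℝ)).exp.hasFDerivAt
    convert! this using 2
    simp [mul_comm]
  have he : MDiffAt (fun y ↦ Real.exp (2 * f y)) x :=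
    h1.differentiableAt.comp_mdifferentiableAt hf
  have h2 := mfderiv_comp_apply x (f := f) h1.differentiableAt.mdifferentiableAt hf u
  rw [mfderiv_eq_fderiv, h1.fderiv] at h2
  have h3 : mvfderiv I (fun y ↦ Real.exp (2 * f y)) x u
      = mvfderiv I f x u * (2 * Real.exp (2 * f x)) := h2
  have h4 := congrArg (fun L ↦ L u) (mvfderiv_mul he (mdifferentiableAt_metric g hY hZ))
  have h5 : mvfderiv I (fun y ↦ (conformalChange g f).inner y (Y y) (Z y)) x u
      = Real.exp (2 * f x) * mvfderiv I (fun y ↦ g.inner y (Y y) (Z y)) x u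
        + g.inner x (Y x) (Z x) * mvfderiv I (fun y ↦ Real.exp (2 * f y)) x u := h4
  have h6 (v w : TangentSpace I x) : (conformalChange g f).inner x v w
      = Real.exp (2 * f x) * g.inner x v w := rfl
  simp only [covDerivMetric, h5, h6, h3]
  ring

variable [FiniteDimensional ℝ E] [CompleteSpace E]

/-- This is ∇(e^{2f} g) = e^{2f} (∇g + 2 df ⊗ g), whose exponential factor never vanishes. -/
theorem isLeviCivita_conformalChange_iff {D : LinearConnection I M} {g : Metric I M}
    {f : C^∞⟮I, M; 𝓘(ℝ, ℝ), ℝ⟯} : IsLeviCivita (conformalChange g f) D ↔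
      D.ContMDiffCovariantDerivative ∞ ∧ D.torsion = 0 ∧ IsLeeForm D g (mvfderiv I f) := by
  constructor
  · rintro ⟨h1, h2, h3⟩
    refine ⟨h1, h2, fun Y Z x hY hZ u ↦ ?_⟩
    have h4 := h3 Y Z x hY hZ u
    rw [covDerivMetric_conformalChange D g f hY hZ, mul_eq_zero] at h4
    have h5 := h4.resolve_left (Real.exp_pos _).ne'
    linarith
  · rintro ⟨h1, h2, h3⟩
    refine ⟨h1, h2, fun Y Z x hY hZ u ↦ ?_⟩
    rw [covDerivMetric_conformalChange D g f hY hZ, h3 Y Z x hY hZ u]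
    ring

end Conformal

theorem trace_prod_orthonormal {V ι : Type*} [NormedAddCommGroup V] [InnerProductSpace ℝ V]
    [Fintype ι] (e : OrthonormalBasis ι ℝ V) (T : (ℝ × V) →ₗ[ℝ] ℝ × V) :
    LinearMap.trace ℝ (ℝ × V) T = (T (1, 0)).1 + ∑ i, inner ℝ (e i) (T (0, e i)).2 := by
  classical
  let β := (Module.Basis.singleton Unit ℝ).prod e.toBasis
  rw [LinearMap.trace_eq_matrix_trace ℝ β, Matrix.trace, Fintype.sum_sum_type]
  simp [β, LinearMap.toMatrix_apply, e.repr_apply_apply]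

/-! ### Existence of the normal vector and of A and S -/

section LieAlgebra

variable {E : Type*} [NormedAddCommGroup E] [NormedSpace ℝ E]
  {H : Type*} [TopologicalSpace H] {I : ModelWithCorners ℝ E H}
  {G : Type*} [TopologicalSpace G] [ChartedSpace H G] [Group G] [LieGroup I ∞ G]
  [CompleteSpace E] [FiniteDimensional ℝ E]
  {g : Metric I G} {𝔥 : LieIdeal ℝ (GroupLieAlgebra I G)}

theorem exists_isUnitNormal (g : Metric I G)
    (h_codim : Module.finrank ℝ 𝔥 + 1 = Module.finrank ℝ E) :
    ∃ b, IsUnitNormal g 𝔥 b := by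
  have : FiniteDimensional ℝ (GroupLieAlgebra I G) := inferInstanceAs (FiniteDimensional ℝ E)
  obtain ⟨ψ, hψ⟩ := lieInner_isometry (g := g)
  let K : Submodule ℝ (EuclideanSpace ℝ (Fin (Module.finrank ℝ E))) :=
    𝔥.toSubmodule.map ψ.toLinearMap
  have hK : Module.finrank ℝ K = Module.finrank ℝ 𝔥 := LinearEquiv.finrank_map_eq ψ 𝔥.toSubmodule
  have h1 : 0 < Module.finrank ℝ Kᗮ := by
    have h2 := K.finrank_add_finrank_orthogonal
    rw [finrank_euclideanSpace_fin, hK] at h2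
    omega
  obtain ⟨⟨w, hw⟩, hw0⟩ := Module.finrank_pos_iff_exists_ne_zero.1 h1
  have hw0' : w ≠ 0 := fun h ↦ hw0 (Subtype.ext h)
  refine ⟨ψ.symm (‖w‖⁻¹ • w), ?_, fun u ↦ ?_⟩
  · rw [← hψ, ψ.apply_symm_apply, real_inner_self_eq_norm_sq, norm_smul, norm_inv, norm_norm,
      inv_mul_cancel₀ (norm_ne_zero_iff.2 hw0'), one_pow]
  · rw [← hψ, ψ.apply_symm_apply, real_inner_smul_left]
    have h3 : inner ℝ w (ψ u) = 0 :=
      (Submodule.mem_orthogonal' K w).1 hw _ (Submodule.mem_map_of_mem u.2)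
    rw [h3, mul_zero]

theorem exists_isometry_ideal (g : Metric I G) (𝔥 : LieIdeal ℝ (GroupLieAlgebra I G)) :
    ∃ ψ : 𝔥 ≃ₗ[ℝ] EuclideanSpace ℝ (Fin (Module.finrank ℝ 𝔥)),
      ∀ u v : 𝔥, inner ℝ (ψ u) (ψ v) = lieInner g u v := by
  have : FiniteDimensional ℝ (GroupLieAlgebra I G) := inferInstanceAs (FiniteDimensional ℝ E)
  have : FiniteDimensional ℝ 𝔥 := inferInstanceAs (FiniteDimensional ℝ 𝔥.toSubmodule)
  exact exists_linearEquiv_euclideanSpace (W := 𝔥)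
    (LinearMap.mk₂ ℝ (fun u v : 𝔥 ↦ lieInner g u v) (by simp [lieInner]) (by simp [lieInner])
      (by simp [lieInner]) (by simp [lieInner])) (fun u v ↦ g.symm 1 u v)
    (fun u hu ↦ g.pos 1 u (by simpa using hu))

theorem exists_isAssociatedPair (g : Metric I G) (𝔥 : LieIdeal ℝ (GroupLieAlgebra I G))
    (b : GroupLieAlgebra I G) : ∃ A S, IsAssociatedPair g 𝔥 b A S := by
  obtain ⟨ψ, hψ⟩ := exists_isometry_ideal g 𝔥
  let T : 𝔥 →ₗ[ℝ] 𝔥 :=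
    { toFun := fun u ↦ ⟨⁅b, (u : GroupLieAlgebra I G)⁆, 𝔥.lie_mem u.2⟩
      map_add' := fun u v ↦ Subtype.ext (by simp)
      map_smul' := fun r u ↦ Subtype.ext (by simp) }
  let T' := ψ.toLinearMap ∘ₗ T ∘ₗ ψ.symm.toLinearMap
  -- The g-adjoint of ad_b on the ideal, formed in Euclidean space and pulled back along ψ.
  let Tad : 𝔥 →ₗ[ℝ] 𝔥 := ψ.symm.toLinearMap ∘ₗ LinearMap.adjoint T' ∘ₗ ψ.toLinearMap
  have hadj (u v : 𝔥) : lieInner g (Tad u) v = lieInner g u (T v) := by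
    rw [← hψ, ← hψ]
    simp [Tad, LinearMap.adjoint_inner_left, T']
  have hsymm (u v : GroupLieAlgebra I G) : lieInner g u v = lieInner g v u := g.symm 1 u v
  have hadj' (u v : 𝔥) : lieInner g (T u) v = lieInner g u (Tad v) := by
    rw [hsymm, ← hadj, hsymm]
  have hadd (u v w : GroupLieAlgebra I G) : lieInner g (u + v) w = lieInner g u w + lieInner g v w := by
    simp [lieInner]
  have hsub (u v w : GroupLieAlgebra I G) : lieInner g (u - v) w = lieInner g u w - lieInner g v w := by
    simp [lieInner]
  have hsmul (r : ℝ) (u w : GroupLieAlgebra I G) : lieInner g (r • u) w = r * lieInner g u w := by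
    simp [lieInner]
  refine ⟨(1 / 2 : ℝ) • (T - Tad), (1 / 2 : ℝ) • (T + Tad), fun u v ↦ ?_, fun u v ↦ ?_, fun u ↦ ?_⟩
  · have h1 := hadj u v
    have h2 := hadj' u v
    rw [hsymm u]
    simp only [LinearMap.smul_apply, LinearMap.sub_apply, LieSubmodule.coe_smul,
      LieSubmodule.coe_sub, hsmul, hsub]
    rw [h1, h2, hsymm u, hsymm u]
    ring
  · have h1 := hadj u v
    have h2 := hadj' u v
    rw [hsymm u]
    simp only [LinearMap.smul_apply, LinearMap.add_apply, LieSubmodule.coe_smul,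
      LieSubmodule.coe_add, hsmul, hadd]
    rw [h1, h2, hsymm u, hsymm u]
    ring
  · have h3 : T u = ((1 / 2 : ℝ) • (T - Tad)) u + ((1 / 2 : ℝ) • (T + Tad)) u := by
      simp only [LinearMap.smul_apply, LinearMap.add_apply, LinearMap.sub_apply]
      module
    exact congrArg Subtype.val h3

end LieAlgebra

/-! ### The model connection satisfies the Koszul conditions -/

section Model

open scoped InnerProductSpace

variable {V : Type*} [NormedAddCommGroup V] [InnerProductSpace ℝ V] [FiniteDimensional ℝ V]
  {A S : V →ₗ[ℝ] V} {t : ℝ} {v : V}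

/-- The bilinear map `weylModel`. -/
def weylBilin (A S : V →ₗ[ℝ] V) (t : ℝ) (v : V) : (ℝ × V) →L[ℝ] (ℝ × V) →L[ℝ] ℝ × V :=
  LinearMap.toContinuousBilinearMap <| LinearMap.mk₂ ℝ (weylModel A S t v)
    (fun X X' Y ↦ by
      ext
      · simp [weylModel, inner_add_left, inner_add_right]; ring
      · simp [weylModel, inner_add_left, inner_add_right]; module)
    (fun r X Y ↦ by
      ext
      · simp [weylModel, inner_smul_left, inner_smul_right]; ring
      · simp [weylModel, inner_smul_left, inner_smul_right]; module)
    (fun X Y Y' ↦ by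
      ext
      · simp [weylModel, inner_add_right]; ring
      · simp [weylModel, inner_add_right]; module)
    (fun r X Y ↦ by
      ext
      · simp [weylModel, inner_smul_right]; ring
      · simp [weylModel, inner_smul_right]; module)

theorem weylBilin_apply (X Y : ℝ × V) : weylBilin A S t v X Y = weylModel A S t v X Y := rfl

/-- With `weylModel_metric` this supplies the hypotheses of `isFrameConnection_of_koszul`: symmetry
of S serves the torsion, skewness of A the metric. -/
theorem weylModel_sub_swap (hS : ∀ x y, ⟪S x, y⟫_ℝ = ⟪x, S y⟫_ℝ) (X Y : ℝ × V) :
    weylModel A S t v X Y - weylModel A S t v Y X = bracketModel A S X Y := by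
  ext
  · simp [weylModel, bracketModel]
    rw [hS X.2, real_inner_comm (S Y.2) X.2, real_inner_comm X.2 Y.2]; ring
  · simp [weylModel, bracketModel]
    rw [real_inner_comm X.2 Y.2]; module

theorem weylModel_metric (hA : ∀ x y, ⟪A x, y⟫_ℝ = -⟪x, A y⟫_ℝ) (X Y Z : ℝ × V) :
    ((weylModel A S t v X Y).1 * Z.1 + ⟪(weylModel A S t v X Y).2, Z.2⟫_ℝ)
      + (Y.1 * (weylModel A S t v X Z).1 + ⟪Y.2, (weylModel A S t v X Z).2⟫_ℝ)
      = 2 * (t * X.1 + ⟪v, X.2⟫_ℝ) * (Y.1 * Z.1 + ⟪Y.2, Z.2⟫_ℝ) := by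
  simp only [weylModel, inner_add_left, inner_add_right, inner_sub_left, inner_sub_right,
    real_inner_smul_left, real_inner_smul_right, inner_neg_left, inner_neg_right, neg_smul]
  rw [hA Y.2 Z.2, real_inner_comm v Y.2, real_inner_comm X.2 Y.2,
    real_inner_comm (S X.2) Y.2]
  ring

end Model

/-! ### Passage from the group to the model -/

section Frame

open scoped InnerProductSpace

variable {E : Type*} [NormedAddCommGroup E] [NormedSpace ℝ E]
  {H : Type*} [TopologicalSpace H] {I : ModelWithCorners ℝ E H} [I.Boundaryless]
  {G : Type*} [TopologicalSpace G] [ChartedSpace H G] [Group G] [LieGroup I ∞ G]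
  [CompleteSpace E] [FiniteDimensional ℝ E] {g : Metric I G} {D : LinearConnection I G}
  {V : Type*} [NormedAddCommGroup V] [InnerProductSpace ℝ V] [FiniteDimensional ℝ V]
  {A S : V →ₗ[ℝ] V} {t : ℝ} {v : V} (Φ : GroupLieAlgebra I G ≃ₗ[ℝ] ℝ × V)

theorem frameCoord_curvature_weylBilin (hg : IsLeftInvariantMetric g)
    (hS : ∀ x y, ⟪S x, y⟫_ℝ = ⟪x, S y⟫_ℝ) (hD : IsFrameConnection D Φ (weylBilin A S t v))
    (hT : D.torsion = 0) (x : G) (X Y Z : TangentSpace I x) :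
    frameCoord Φ x (curvature D x X Y Z)
      = curvatureModel A S t v (frameCoord Φ x X) (frameCoord Φ x Y) (frameCoord Φ x Z) := by
  rw [hD.frameCoord_curvature Φ hg hT]
  simp only [weylBilin_apply]
  rw [weylModel_sub_swap hS]
  rfl

theorem ricci_eq_ricciModel (hg : IsLeftInvariantMetric g)
    (hS : ∀ x y, ⟪S x, y⟫_ℝ = ⟪x, S y⟫_ℝ) (hD : IsFrameConnection D Φ (weylBilin A S t v))
    (hT : D.torsion = 0) {ι : Type*} [Fintype ι] (e : OrthonormalBasis ι ℝ V) (x : G)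
    (X Y : TangentSpace I x) :
    ricci D x X Y = ricciModel e A S t v (frameCoord Φ x X) (frameCoord Φ x Y) := by
  classical
  let Γ := weylBilin A S t v
  let a := frameCoord Φ x X
  let c := frameCoord Φ x Y
  -- Written as a composite of linear maps, the curvature is visibly linear in its middle argument,
  -- so its trace may be conjugated to the orthonormal basis of the model.
  let R : (ℝ × V) →ₗ[ℝ] ℝ × V := ((Γ.flip c).comp (Γ a - Γ.flip a) - (Γ a).comp (Γ.flip c)
    + Γ.flip (Γ a c)).toLinearMap
  have hR (Z : ℝ × V) : R Z = curvatureModel A S t v a Z c := by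
    rw [curvatureModel, ← weylModel_sub_swap (t := t) (v := v) hS]
    rfl
  have h1 : ricci D x X Y = LinearMap.trace ℝ _ ((frameCoord Φ x).symm.conj R) := by
    rw [LinearMap.trace_eq_matrix_trace ℝ (tangentBasis x), Matrix.trace, ricci]
    refine Finset.sum_congr rfl fun i _ ↦ ?_
    rw [Matrix.diag_apply, LinearMap.toMatrix_apply, Module.Basis.coord_apply,
      LinearEquiv.conj_apply_apply, LinearEquiv.symm_symm, hR,
      ← frameCoord_curvature_weylBilin Φ hg hS hD hT, LinearEquiv.symm_apply_apply]
  rw [h1, LinearMap.trace_conj', trace_prod_orthonormal e, ricciModel]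
  simp only [hR, a, c]

variable {𝔥 : LieIdeal ℝ (GroupLieAlgebra I G)} {b : GroupLieAlgebra I G}

theorem exists_adapted_frame (hb : IsUnitNormal g 𝔥 b)
    (h_codim : Module.finrank ℝ 𝔥 + 1 = Module.finrank ℝ E) :
    ∃ (ψ : 𝔥 ≃ₗ[ℝ] EuclideanSpace ℝ (Fin (Module.finrank ℝ 𝔥)))
      (Φ : GroupLieAlgebra I G ≃ₗ[ℝ] ℝ × EuclideanSpace ℝ (Fin (Module.finrank ℝ 𝔥))),
      (∀ u w : 𝔥, ⟪ψ u, ψ w⟫_ℝ = lieInner g u w) ∧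
      (∀ X, Φ.symm X = X.1 • b + (ψ.symm X.2 : GroupLieAlgebra I G)) ∧
      ∀ X Y, lieInner g (Φ.symm X) (Φ.symm Y) = X.1 * Y.1 + ⟪X.2, Y.2⟫_ℝ := by
  have : FiniteDimensional ℝ (GroupLieAlgebra I G) := inferInstanceAs (FiniteDimensional ℝ E)
  obtain ⟨ψ, hψ⟩ := exists_isometry_ideal g 𝔥
  let Ψ : ℝ × EuclideanSpace ℝ (Fin (Module.finrank ℝ 𝔥)) →ₗ[ℝ] GroupLieAlgebra I G :=
    { toFun := fun X ↦ X.1 • b + (ψ.symm X.2 : GroupLieAlgebra I G)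
      map_add' := fun X Y ↦ by simp; module
      map_smul' := fun r X ↦ by simp; module }
  have hΨ (X Y) : lieInner g (Ψ X) (Ψ Y) = X.1 * Y.1 + ⟪X.2, Y.2⟫_ℝ := by
    have h1 : lieInner g (Ψ X) (Ψ Y) = X.1 * Y.1 * lieInner g b b
        + X.1 * lieInner g b (ψ.symm Y.2) + Y.1 * lieInner g (ψ.symm X.2) b
        + lieInner g (ψ.symm X.2) (ψ.symm Y.2) := by
      simp [lieInner, Ψ]
      ring
    have h2 (u : 𝔥) : lieInner g u b = 0 := (g.symm 1 u b).trans (hb.orthogonal u)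
    rw [h1, hb.unit, hb.orthogonal, h2, ← hψ, ψ.apply_symm_apply, ψ.apply_symm_apply]
    ring
  have hinj : Function.Injective Ψ := by
    rw [injective_iff_map_eq_zero]
    intro X hX
    have h1 := hΨ X X
    rw [hX] at h1
    have h2 : lieInner g (0 : GroupLieAlgebra I G) 0 = 0 := by simp [lieInner]
    rw [h2, real_inner_self_eq_norm_sq] at h1
    have h3 : X.1 = 0 := by nlinarith [sq_nonneg X.1, sq_nonneg ‖X.2‖]
    have h4 : X.2 = 0 := by
      rw [h3] at h1
      simpa using h1.symm
    exact Prod.ext h3 h4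
  have hfr : Module.finrank ℝ (ℝ × EuclideanSpace ℝ (Fin (Module.finrank ℝ 𝔥)))
      = Module.finrank ℝ (GroupLieAlgebra I G) := by
    rw [Module.finrank_prod, Module.finrank_self, finrank_euclideanSpace_fin, add_comm]
    exact h_codim
  exact ⟨ψ, (LinearEquiv.ofInjectiveOfFinrankEq Ψ hinj hfr).symm, hψ, fun X ↦ rfl, hΨ⟩

end Frame

/-! ### The theorem for an adapted frame -/

section Core

open scoped InnerProductSpace

variable {E : Type*} [NormedAddCommGroup E] [NormedSpace ℝ E]
  {H : Type*} [TopologicalSpace H] {I : ModelWithCorners ℝ E H} [I.Boundaryless]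
  {G : Type*} [TopologicalSpace G] [ChartedSpace H G] [Group G] [LieGroup I ∞ G]
  [CompleteSpace E] [FiniteDimensional ℝ E] {g : Metric I G} {D : LinearConnection I G}
  {𝔥 : LieIdeal ℝ (GroupLieAlgebra I G)} {b : GroupLieAlgebra I G} {A S : 𝔥 →ₗ[ℝ] 𝔥}
  {V : Type*} [NormedAddCommGroup V] [InnerProductSpace ℝ V]
  {ψ : 𝔥 ≃ₗ[ℝ] V} {Φ : GroupLieAlgebra I G ≃ₗ[ℝ] ℝ × V}

theorem lie_adapted_frame (h_abelian : IsLieAbelian 𝔥) (hAS : IsAssociatedPair g 𝔥 b A S)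
    (hΦ : ∀ X, Φ.symm X = X.1 • b + (ψ.symm X.2 : GroupLieAlgebra I G)) (X Y : ℝ × V) :
    ⁅Φ.symm X, Φ.symm Y⁆ = Φ.symm (bracketModel (ψ.conj A) (ψ.conj S) X Y) := by
  have h0 : ⁅(ψ.symm X.2 : GroupLieAlgebra I G), (ψ.symm Y.2 : GroupLieAlgebra I G)⁆ = 0 := by
    have h : ⁅ψ.symm X.2, ψ.symm Y.2⁆ = 0 := LieModule.IsTrivial.trivial _ _
    exact congrArg Subtype.val h
  have h1 (u : 𝔥) : ⁅(u : GroupLieAlgebra I G), b⁆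
      = -((A u : GroupLieAlgebra I G) + (S u : GroupLieAlgebra I G)) := by
    rw [← lie_skew, hAS.add]
  have h2 : ψ.symm (bracketModel (ψ.conj A) (ψ.conj S) X Y).2
      = X.1 • (A (ψ.symm Y.2) + S (ψ.symm Y.2)) - Y.1 • (A (ψ.symm X.2) + S (ψ.symm X.2)) := by
    simp [bracketModel, LinearEquiv.conj_apply_apply]
  rw [hΦ, hΦ, hΦ, h2]
  simp only [lie_add, add_lie, lie_smul, smul_lie, lie_self, h0, h1, hAS.add, bracketModel]
  simp
  module

variable [FiniteDimensional ℝ V]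

theorem isFrameConnection_adapted (h_abelian : IsLieAbelian 𝔥) (hAS : IsAssociatedPair g 𝔥 b A S)
    (hΦ : ∀ X, Φ.symm X = X.1 • b + (ψ.symm X.2 : GroupLieAlgebra I G))
    (hΦg : ∀ X Y, lieInner g (Φ.symm X) (Φ.symm Y) = X.1 * Y.1 + ⟪X.2, Y.2⟫_ℝ)
    (hA : ∀ x y, ⟪ψ.conj A x, y⟫_ℝ = -⟪x, ψ.conj A y⟫_ℝ)
    (hS : ∀ x y, ⟪ψ.conj S x, y⟫_ℝ = ⟪x, ψ.conj S y⟫_ℝ)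
    (hg : IsLeftInvariantMetric g) {θ : OneForm I G} (hθ : IsLeftInvariantForm θ)
    {t : ℝ} {v : V} (htv : ∀ X : ℝ × V, θ 1 (Φ.symm X) = t * X.1 + ⟪v, X.2⟫_ℝ)
    (hDθ : IsLeeForm D g θ) (hT : D.torsion = 0) :
    IsFrameConnection D Φ (weylBilin (ψ.conj A) (ψ.conj S) t v) := by
  refine isFrameConnection_of_koszul Φ hg hθ hDθ hT (fun X Y ↦ ?_) fun X Y Z ↦ ?_
  · rw [weylBilin_apply, weylBilin_apply, weylModel_sub_swap hS]
    apply Φ.symm.injective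
    rw [← lie_adapted_frame h_abelian hAS hΦ]
    simp
  · have h1 := weylModel_metric (S := ψ.conj S) (t := t) (v := v) hA (Φ X) (Φ Y) (Φ Z)
    rw [← htv, Φ.symm_apply_apply] at h1
    have h2 (U : ℝ × V) (Z : GroupLieAlgebra I G) : lieInner g (Φ.symm U) Z
        = U.1 * (Φ Z).1 + ⟪U.2, (Φ Z).2⟫_ℝ := by
      rw [← hΦg, Φ.symm_apply_apply]
    have h3 (U : ℝ × V) (Z : GroupLieAlgebra I G) : lieInner g Z (Φ.symm U)
        = (Φ Z).1 * U.1 + ⟪(Φ Z).2, U.2⟫_ℝ := by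
      rw [← hΦg, Φ.symm_apply_apply]
    rw [h2, h3, weylBilin_apply, weylBilin_apply, h1, ← hΦg, Φ.symm_apply_apply, Φ.symm_apply_apply]

/-- The algebraic condition characterising flatness. -/
def IsFlatCondition (g : Metric I G) (𝔥 : LieIdeal ℝ (GroupLieAlgebra I G)) (S : 𝔥 →ₗ[ℝ] 𝔥) :
    Prop :=
  (∃ k : ℝ, ∀ u : 𝔥, S u = k • u) ∨
    ∃ U : Submodule ℝ 𝔥, Module.finrank ℝ U + 1 = Module.finrank ℝ 𝔥 ∧
      (∃ α : ℝ, ∀ u ∈ U, S u = α • u) ∧ ∀ w : 𝔥, (∀ u ∈ U, lieInner g w u = 0) → S w = 0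

theorem isFlatCondition_iff_conj (hψ : ∀ u w : 𝔥, ⟪ψ u, ψ w⟫_ℝ = lieInner g u w) :
    ((∃ k : ℝ, ∀ u, ψ.conj S u = k • u) ∨ ∃ U : Submodule ℝ V,
      Module.finrank ℝ U + 1 = Module.finrank ℝ V ∧ (∃ α : ℝ, ∀ u ∈ U, ψ.conj S u = α • u) ∧
        ∀ w, (∀ u ∈ U, ⟪w, u⟫_ℝ = 0) → ψ.conj S w = 0) ↔ IsFlatCondition g 𝔥 S := by
  have hc (u : 𝔥) : ψ.conj S (ψ u) = ψ (S u) := by simp [LinearEquiv.conj_apply_apply]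
  have hc' (x : V) (k : ℝ) : ψ.conj S x = k • x ↔ S (ψ.symm x) = k • ψ.symm x := by
    rw [LinearEquiv.conj_apply_apply, ← map_smul, LinearEquiv.eq_symm_apply]
  have h0 (x : V) : ψ.conj S x = 0 ↔ S (ψ.symm x) = 0 := by
    simp
  refine or_congr ?_ ?_
  · exact exists_congr fun k ↦ ⟨fun h u ↦ by simpa using (hc' _ k).1 (h (ψ u)),
      fun h x ↦ (hc' x k).2 (h _)⟩
  · constructor
    · rintro ⟨U, h1, ⟨α, h2⟩, h3⟩
      refine ⟨U.map ψ.symm.toLinearMap, ?_, ⟨α, ?_⟩, fun w hw ↦ ?_⟩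
      · rw [LinearEquiv.finrank_map_eq, h1, ψ.finrank_eq]
      · rintro _ ⟨x, hx, rfl⟩
        exact (hc' x α).1 (h2 x hx)
      · have h4 := (h0 (ψ w)).1 (h3 (ψ w) fun u hu ↦ by
          have := hw (ψ.symm u) (Submodule.mem_map_of_mem hu)
          rwa [← hψ, ψ.apply_symm_apply] at this)
        simpa using h4
    · rintro ⟨U, h1, ⟨α, h2⟩, h3⟩
      refine ⟨U.map ψ.toLinearMap, ?_, ⟨α, ?_⟩, fun w hw ↦ ?_⟩
      · rw [LinearEquiv.finrank_map_eq, h1, ψ.finrank_eq]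
      · rintro _ ⟨x, hx, rfl⟩
        exact (hc' _ α).2 (by simpa using h2 x hx)
      · refine (h0 w).2 (h3 _ fun u hu ↦ ?_)
        rw [← hψ, ψ.apply_symm_apply]
        exact hw _ (Submodule.mem_map_of_mem hu)

/-- The ideal is abelian and A is skew, so only the b-component of X and the trace of S contribute.
This exhibits the Lee form as a multiple of tr ad. -/
theorem trace_ad_adapted {ι : Type*} [Fintype ι] (e : OrthonormalBasis ι ℝ V) {σ : ι → ℝ}
    (h_abelian : IsLieAbelian 𝔥) (hAS : IsAssociatedPair g 𝔥 b A S)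
    (hΦ : ∀ X, Φ.symm X = X.1 • b + (ψ.symm X.2 : GroupLieAlgebra I G))
    (hA : ∀ x y, ⟪ψ.conj A x, y⟫_ℝ = -⟪x, ψ.conj A y⟫_ℝ) (hσ : ∀ i, ψ.conj S (e i) = σ i • e i)
    (X : GroupLieAlgebra I G) :
    LinearMap.trace ℝ _ (LieAlgebra.ad ℝ (GroupLieAlgebra I G) X) = (Φ X).1 * ∑ i, σ i := by
  have hT (Y) : Φ.conj (LieAlgebra.ad ℝ (GroupLieAlgebra I G) X) Y
      = bracketModel (ψ.conj A) (ψ.conj S) (Φ X) Y := by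
    have h1 := lie_adapted_frame h_abelian hAS hΦ (Φ X) Y
    rw [Φ.symm_apply_apply] at h1
    rw [LinearEquiv.conj_apply_apply, LieAlgebra.ad_apply, h1, Φ.apply_symm_apply]
  rw [← LinearMap.trace_conj' _ Φ, trace_prod_orthonormal e, Finset.mul_sum]
  simp only [hT, bracketModel, zero_add]
  refine Finset.sum_congr rfl fun i _ ↦ ?_
  simp only [hσ, inner_add_right, inner_smul_right, inner_skew_self hA, e.inner_eq_one, zero_smul,
    sub_zero]
  ring

/-- The Einstein equation at 1 suffices, since the frame expression of the Ricci tensor is the same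
at every point. Letting `D'` range over all torsion-free connections with Lee form θ covers every
witness of flatness without a separate uniqueness statement. -/
theorem weylEinstein_frame {ι : Type*} [Fintype ι] (e : OrthonormalBasis ι ℝ V) {σ : ι → ℝ}
    (h_abelian : IsLieAbelian 𝔥) (hm : 2 ≤ Fintype.card ι)
    (hAS : IsAssociatedPair g 𝔥 b A S)
    (hψ : ∀ u w : 𝔥, ⟪ψ u, ψ w⟫_ℝ = lieInner g u w)
    (hΦ : ∀ X, Φ.symm X = X.1 • b + (ψ.symm X.2 : GroupLieAlgebra I G))
    (hΦg : ∀ X Y, lieInner g (Φ.symm X) (Φ.symm Y) = X.1 * Y.1 + ⟪X.2, Y.2⟫_ℝ)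
    (hA : ∀ x y, ⟪ψ.conj A x, y⟫_ℝ = -⟪x, ψ.conj A y⟫_ℝ)
    (hS : ∀ x y, ⟪ψ.conj S x, y⟫_ℝ = ⟪x, ψ.conj S y⟫_ℝ)
    (hσ : ∀ i, ψ.conj S (e i) = σ i • e i)
    (hg : IsLeftInvariantMetric g) {θ : OneForm I G} (hθ : IsLeftInvariantForm θ)
    (hDθ : IsLeeForm D g θ) (hT : D.torsion = 0) (hne : θ ≠ 0)
    {t : ℝ} {v : V} (htv : ∀ X : ℝ × V, θ 1 (Φ.symm X) = t * X.1 + ⟪v, X.2⟫_ℝ) {μ : ℝ}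
    (hE : ∀ X Y : GroupLieAlgebra I G, ricci D 1 X Y + ricci D 1 Y X = 2 * μ * lieInner g X Y) :
    (∃ f : C^∞⟮I, G; 𝓘(ℝ, ℝ), ℝ⟯, mvfderiv I f = θ) ∧
      (∀ (x : G) (X Y : TangentSpace I x), ricci D x X Y = 0) ∧
      ∀ D' : LinearConnection I G, D'.torsion = 0 → IsLeeForm D' g θ →
        ((∀ (x : G) (X Y Z : TangentSpace I x), curvature D' x X Y Z = 0) ↔
          IsFlatCondition g 𝔥 S) := by
  have hframe (D' : LinearConnection I G) (hT' : D'.torsion = 0) (hDθ' : IsLeeForm D' g θ) :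
      IsFrameConnection D' Φ (weylBilin (ψ.conj A) (ψ.conj S) t v) :=
    isFrameConnection_adapted h_abelian hAS hΦ hΦg hA hS hg hθ htv hDθ' hT'
  have hone (X : GroupLieAlgebra I G) : frameCoord Φ 1 X = Φ X := by
    rw [← frameCoord_mulInvariantVectorField Φ 1 X, mulInvariantVectorField_one]
  have hric (x : G) (X Y : TangentSpace I x) :=
    ricci_eq_ricciModel Φ hg hS (hframe D hT hDθ) hT e x X Y
  have hne' : t ≠ 0 ∨ v ≠ 0 := by
    by_contra! h
    apply hne
    ext x u
    obtain ⟨X, rfl⟩ := (leftTranslation x).surjective u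
    rw [leftTranslation_apply, hθ.apply_mulInvariantVectorField, ← Φ.symm_apply_apply X, htv,
      h.1, h.2]
    simp
  have hE' (X Y : ℝ × V) : ricciModel e (ψ.conj A) (ψ.conj S) t v X Y
      + ricciModel e (ψ.conj A) (ψ.conj S) t v Y X = 2 * μ * (X.1 * Y.1 + ⟪X.2, Y.2⟫_ℝ) := by
    have h1 := hE (Φ.symm X) (Φ.symm Y)
    rw [hric, hric, hone, hone, Φ.apply_symm_apply, Φ.apply_symm_apply] at h1
    rw [← hΦg, h1]
  obtain ⟨rfl, ht, hric0, hQ, hs, hSA⟩ := weylEinstein_model e hm hA hS hσ hE' hne'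
  refine ⟨?_, fun x X Y ↦ by rw [hric, hric0], fun D' hT' hDθ' ↦ ?_⟩
  -- With v = 0, θ(X) is t times the b-component of X, and tr ad_X is s times it; hence c = t / s.
  · refine (hframe D hT hDθ).exists_primitive Φ hg hT hθ (c := t / ∑ i, σ i) fun X ↦ ?_
    rw [trace_ad_adapted e h_abelian hAS hΦ hA hσ, ← Φ.symm_apply_apply X, htv]
    field_simp
    simp
  · have hcurv (x : G) (X Y Z : TangentSpace I x) :=
      frameCoord_curvature_weylBilin Φ hg hS (hframe D' hT' hDθ') hT' x X Y Z
    rw [← isFlatCondition_iff_conj hψ, ← curvatureModel_eq_zero_iff e hA hS hσ hQ hs hSA]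
    constructor
    · intro h X Y Z
      have h1 := hcurv 1 ((frameCoord Φ 1).symm X) ((frameCoord Φ 1).symm Y)
        ((frameCoord Φ 1).symm Z)
      rw [h, map_zero] at h1
      simpa using h1.symm
    · intro h x X Y Z
      apply (frameCoord Φ x).injective
      rw [hcurv, h, map_zero]

theorem weylEinstein_core (h_abelian : IsLieAbelian 𝔥)
    (h_codim : Module.finrank ℝ 𝔥 + 1 = Module.finrank ℝ E) (hm : 2 ≤ Module.finrank ℝ 𝔥)
    (hg : IsLeftInvariantMetric g) {θ : OneForm I G} (hθ : IsLeftInvariantForm θ)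
    (hDθ : IsLeeForm D g θ) (hT : D.torsion = 0) (hne : θ ≠ 0) {μ : ℝ}
    (hE : ∀ X Y : GroupLieAlgebra I G, ricci D 1 X Y + ricci D 1 Y X = 2 * μ * lieInner g X Y)
    (hb : IsUnitNormal g 𝔥 b) (hAS : IsAssociatedPair g 𝔥 b A S) :
    (∃ f : C^∞⟮I, G; 𝓘(ℝ, ℝ), ℝ⟯, mvfderiv I f = θ) ∧
      (∀ (x : G) (X Y : TangentSpace I x), ricci D x X Y = 0) ∧
      ∀ D' : LinearConnection I G, D'.torsion = 0 → IsLeeForm D' g θ →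
        ((∀ (x : G) (X Y Z : TangentSpace I x), curvature D' x X Y Z = 0) ↔
          IsFlatCondition g 𝔥 S) := by
  obtain ⟨ψ, Φ, hψ, hΦ, hΦg⟩ := exists_adapted_frame hb h_codim
  have hinn (x y) : ⟪x, y⟫_ℝ = lieInner g (ψ.symm x) (ψ.symm y) := by
    rw [← hψ, ψ.apply_symm_apply, ψ.apply_symm_apply]
  have hA (x y) : ⟪ψ.conj A x, y⟫_ℝ = -⟪x, ψ.conj A y⟫_ℝ := by
    rw [hinn, hinn]
    simpa [LinearEquiv.conj_apply_apply] using hAS.skew (ψ.symm x) (ψ.symm y)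
  have hS (x y) : ⟪ψ.conj S x, y⟫_ℝ = ⟪x, ψ.conj S y⟫_ℝ := by
    rw [hinn, hinn]
    simpa [LinearEquiv.conj_apply_apply] using hAS.symm (ψ.symm x) (ψ.symm y)
  have hsym : (ψ.conj S).IsSymmetric := hS
  obtain ⟨e, σ, hσ⟩ : ∃ (e : OrthonormalBasis (Fin (Module.finrank ℝ 𝔥)) ℝ
      (EuclideanSpace ℝ (Fin (Module.finrank ℝ 𝔥)))) (σ : Fin (Module.finrank ℝ 𝔥) → ℝ),
      ∀ i, ψ.conj S (e i) = σ i • e i :=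
    ⟨_, _, hsym.apply_eigenvectorBasis finrank_euclideanSpace_fin⟩
  obtain ⟨v, hv⟩ : ∃ v, ∀ x, θ 1 (ψ.symm x : GroupLieAlgebra I G) = ⟪v, x⟫_ℝ := by
    let ℓ : EuclideanSpace ℝ (Fin (Module.finrank ℝ 𝔥)) →ₗ[ℝ] ℝ :=
      (θ 1).toLinearMap ∘ₗ 𝔥.toSubmodule.subtype ∘ₗ ψ.symm.toLinearMap
    exact ⟨(InnerProductSpace.toDual ℝ _).symm ℓ.toContinuousLinearMap,
      fun x ↦ by rw [InnerProductSpace.toDual_symm_apply]; rfl⟩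
  have hm' : 2 ≤ Fintype.card (Fin (Module.finrank ℝ 𝔥)) := by rwa [Fintype.card_fin]
  have htv (X) : θ 1 (Φ.symm X) = θ 1 b * X.1 + ⟪v, X.2⟫_ℝ := by
    rw [hΦ, map_add, map_smul, hv, smul_eq_mul, mul_comm]
  exact weylEinstein_frame e h_abelian hm' hAS hψ hΦ hΦg hA hS hσ hg hθ hDθ hT hne htv hE

end Core

/-! ### The Einstein condition at the identity -/

section Einstein

variable {E : Type*} [NormedAddCommGroup E] [NormedSpace ℝ E] [FiniteDimensional ℝ E]
  [CompleteSpace E] {H : Type*} [TopologicalSpace H] {I : ModelWithCorners ℝ E H}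
  {G : Type*} [TopologicalSpace G] [ChartedSpace H G] [Group G] [LieGroup I ∞ G]

/-- The metric in the Einstein condition may differ from g by a conformal factor; at the single
point 1 this factor is absorbed into μ. -/
theorem IsWeylEinstein.exists_ricci_one {c : ConformalClass I G} {D : LinearConnection I G}
    (h : IsWeylEinstein c D) {g : Metric I G} (hg : c.Contains g) :
    ∃ μ : ℝ, ∀ X Y : GroupLieAlgebra I G,
      ricci D 1 X Y + ricci D 1 Y X = 2 * μ * lieInner g X Y := by
  obtain ⟨g₂, hg₂, h⟩ := h
  obtain ⟨f, hf⟩ := Quotient.exact (Eq.trans hg (Eq.symm hg₂))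
  refine ⟨scalarCurvature D g₂ 1 / Module.finrank ℝ E * Real.exp (2 * f 1), fun X Y ↦ ?_⟩
  have h1 := h 1 X Y
  rw [hf] at h1
  rw [lieInner]
  linear_combination 2 * h1

end Einstein

end WeylGeometry

end

/-! ### The main theorem -/

theorem mainTheorem8 (n : ℕ) (hn : 3 ≤ n) (G : Type*) [TopologicalSpace G]
    [ChartedSpace (EuclideanSpace ℝ (Fin n)) G] [Group G] [LieGroup (𝓡 n) ∞ G]
    [SimplyConnectedSpace G]
    -- an abelian ideal of codimension one in the Lie algebra
    (𝔥 : LieIdeal ℝ (GroupLieAlgebra (𝓡 n) G)) (h_abelian : IsLieAbelian 𝔥)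
    (h_codim : Module.finrank ℝ 𝔥 + 1 = n)
    -- a left-invariant conformal structure, and a left-invariant Weyl-Einstein structure on it
    (c : WeylGeometry.ConformalClass (𝓡 n) G)
    (D : WeylGeometry.LinearConnection (𝓡 n) G)
    (hD : WeylGeometry.IsWeylStructure c D)
    (hD_inv : WeylGeometry.IsLeftInvariantWeyl c D)
    (hD_einstein : WeylGeometry.IsWeylEinstein c D)
    -- a left-invariant metric in the conformal class, and the Lee form with respect to it
    (g : WeylGeometry.Metric (𝓡 n) G) (hg : c.Contains g)
    (hg_inv : WeylGeometry.IsLeftInvariantMetric g)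
    (θ : WeylGeometry.OneForm (𝓡 n) G) (hθ : WeylGeometry.IsLeeForm D g θ) (hθ_ne : θ ≠ 0) :
    (∃ f : C^∞⟮𝓡 n, G; 𝓘(ℝ, ℝ), ℝ⟯, mvfderiv (𝓡 n) f = θ) ∧
    ∀ f : C^∞⟮𝓡 n, G; 𝓘(ℝ, ℝ), ℝ⟯, mvfderiv (𝓡 n) f = θ →
      WeylGeometry.IsRicciFlat (WeylGeometry.conformalChange g f) ∧
      ∀ (b : GroupLieAlgebra (𝓡 n) G) (A S : 𝔥 →ₗ[ℝ] 𝔥),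
        WeylGeometry.IsUnitNormal g 𝔥 b → WeylGeometry.IsAssociatedPair g 𝔥 b A S →
        (WeylGeometry.IsFlat (WeylGeometry.conformalChange g f) ↔
          (∃ k : ℝ, ∀ u : 𝔥, S u = k • u) ∨
          ∃ U : Submodule ℝ 𝔥, Module.finrank ℝ U + 1 = Module.finrank ℝ 𝔥 ∧
            (∃ α : ℝ, ∀ u ∈ U, S u = α • u) ∧
            ∀ w : 𝔥, (∀ u ∈ U, WeylGeometry.lieInner g w u = 0) → S w = 0) := by
  have hfin : Module.finrank ℝ (EuclideanSpace ℝ (Fin n)) = n := finrank_euclideanSpace_fin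
  have hcod : Module.finrank ℝ 𝔥 + 1 = Module.finrank ℝ (EuclideanSpace ℝ (Fin n)) := by
    rw [hfin, h_codim]
  have hm : 2 ≤ Module.finrank ℝ 𝔥 := by omega
  have hθ_inv := hD_inv g hg hg_inv θ hθ
  obtain ⟨μ, hE⟩ := hD_einstein.exists_ricci_one hg
  have core {b : GroupLieAlgebra (𝓡 n) G} {A S : 𝔥 →ₗ[ℝ] 𝔥} (hb : WeylGeometry.IsUnitNormal g 𝔥 b)
      (hAS : WeylGeometry.IsAssociatedPair g 𝔥 b A S) :=
    WeylGeometry.weylEinstein_core h_abelian hcod hm hg_inv hθ_inv hθ hD.torsion_eq_zero hθ_ne hE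
      hb hAS
  -- Exactness and Ricci-flatness do not involve b, A or S, so any choice of them serves.
  obtain ⟨b₀, hb₀⟩ := WeylGeometry.exists_isUnitNormal g hcod
  obtain ⟨A₀, S₀, hAS₀⟩ := WeylGeometry.exists_isAssociatedPair g 𝔥 b₀
  refine ⟨(core hb₀ hAS₀).1, fun f hf ↦ ?_⟩
  have hLC : WeylGeometry.IsLeviCivita (WeylGeometry.conformalChange g f) D :=
    WeylGeometry.isLeviCivita_conformalChange_iff.2
      ⟨hD.smooth, hD.torsion_eq_zero, by rwa [hf]⟩
  refine ⟨⟨D, hLC, (core hb₀ hAS₀).2.1⟩, fun b A S hb hAS ↦ ⟨?_, fun h ↦ ?_⟩⟩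
  · rintro ⟨D', hD', h⟩
    -- A witness of flatness may be a connection other than `D` a priori, but its Lee form with
    -- respect to g is df = θ, so `core` applies to it.
    obtain ⟨-, hT, hL⟩ := WeylGeometry.isLeviCivita_conformalChange_iff.1 hD'
    rw [hf] at hL
    exact ((core hb hAS).2.2 D' hT hL).1 h
  · exact ⟨D, hLC, ((core hb hAS).2.2 D hD.torsion_eq_zero hθ).2 h⟩
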